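/- Let $M$ be a finite-dimensional $C^1$ manifold without boundary (compact or not), with a continuous Riemannian metric $\|\cdot\|$ and a distance $d$ inducing its topology, and let $f:M\to M$ be a $C^1$ diffeomorphism. For $x\in M$ and $\epsilon>0$ put \[W^s_\epsilon(x)=\{y: d(f^n(x),f^n(y))<\epsilon\ \ \forall n\ge 0\},\qquad W^s(x)=\{y: d(f^n(x),f^n(y))\to 0\ (n\to+\infty)\},\] and let $W^u_\epsilon(x)$, $W^u(x)$ be the same sets for $f^{-1}$. Let $K\subset M$ be compact with $f(K)=K$. Let $Per(f|K)$ be the set of periodic points of $f$ in $K$, and let $\Omega(f|K)$ be the set of $x\in K$ such that for every neighbourhood $U$ of $x$ in $K$ there is $n>0$ with $f^n(U)\cap U\neq\emptyset$. Suppose that $K$ is $AS$, that is: (i) $\Omega(f|K)=\overline{Per(f|K)}$, and this compact invariant set $\Lambda$ is hyperbolic: $TM|_\Lambda=E^s\oplus E^u$ with $Tf$-invariant subbundles (one of which may be zero), and there are $C>0$, $\lambda\in(0,1)$ with $\|Tf^n v\|\le C\lambda^n\|v\|$ for $v\in E^s$ and $\|Tf^{-n}v\|\le C\lambda^n\|v\|$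 for $v\in E^u$, for all $n\ge0$; (ii) for all sufficiently small $\epsilon>0$ and all $x,y\in K$, the local stable manifold $W^s_\epsilon(x)$ and the local unstable manifold $W^u_\epsilon(y)$ are transverse (at each common point their tangent spaces together span the tangent space of $M$), and their (possibly empty) intersection is contained in $K$. For $x,y\in Per(f|K)$ write $x\sim y$ if $W^s(x)\cap W^u(y)\cap K\ne\emptyset$ and $W^s(y)\cap W^u(x)\cap K\neq\emptyset$. The basic sets of $f|K$ are the sets $\bigcup_{n\ge0}f^n\big(\overline{\{x\in Per(f|K): x\sim p\}}\big)$, $p\in Per(f|K)$; together they form the spectral decomposition of $\Lambda$. For a basic set $B$ let $W^s_B=\{x\in K: d(f^n(x),B)\to0\ (n\to+\infty)\}$ and $W^u_B=\{x\in K: d(f^{-n}(x),B)\to0\ (n\to+\infty)\}$. For basic sets $A,B$ write $A\succ B$ if $(W^u_A\setminus A)\cap(W^s_B\setminus B)\ne\emptyset$, and $A\succeq B$ if $A\succ B$ or $A=B$. Then: (1) (no-cycle condition) if $\Lambda_1,\dots,\Lambda_n,\Lambda_{n+1}=\Lambda_1$ are basic sets with $\Lambda_{j+1}\succeq\Lambda_j$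 for $1\le j\le n$, then $\Lambda_j=\Lambda_{j+1}$ for all $1\le j\le n$; (2) the relation $\succ$ can be completed to a total order: there is a total order on the set of basic sets, with strict part $<$, such that $A\succ B$ implies $B<A$ for all basic sets $A,B$ (in particular, $A\succ A$ never holds). -/

import Mathlib

open Set Filter Topology Bundle
open scoped Manifold ContDiff

namespace ASCompact

section Metric

variable {M : Type*} [MetricSpace M]

/-- The stable set `W^s(x)`: the points whose forward orbit is asymptotic to that of `x`. -/
def stableSet (f : M ≃ M) (x : M) : Set M :=
  {y | Tendsto (fun n : ℕ => dist (f^[n] x) (f^[n] y)) atTop (𝓝 0)}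

/-- The unstable set `W^u(x)`: the stable set of `x` for the inverse map. -/
def unstableSet (f : M ≃ M) (x : M) : Set M := stableSet f.symm x

/-- The `ε`-local stable manifold `W^s_ε(x)`. -/
def localStable (f : M ≃ M) (ε : ℝ) (x : M) : Set M :=
  {y | ∀ n : ℕ, dist (f^[n] x) (f^[n] y) < ε}

/-- The `ε`-local unstable manifold `W^u_ε(x)`. -/
def localUnstable (f : M ≃ M) (ε : ℝ) (x : M) : Set M := localStable f.symm ε x

/-- The set `Per(f|K)` of the periodic points of `f` in `K`. -/
def periodicIn (f : M ≃ M) (K : Set M) : Set M := K ∩ Function.periodicPts f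

/-- The nonwandering set `Ω(f|K)` of the restriction of `f` to the invariant set `K`: the points
`x` of `K` such that every neighbourhood `U ∩ K` of `x` in `K` meets some `f^n(U ∩ K)`, `n > 0`. -/
def nonwandering (f : M ≃ M) (K : Set M) : Set M :=
  {x | x ∈ K ∧ ∀ U ∈ 𝓝 x, ∃ n : ℕ, 0 < n ∧ ∃ y ∈ U ∩ K, f^[n] y ∈ U ∩ K}

/-- The relation `x ∼ y` (used for periodic points `x`, `y` of `K`): `W^s(x)` meets `W^u(y)` in `K`
and `W^s(y)` meets `W^u(x)` in `K`. -/
def Related (f : M ≃ M) (K : Set M) (x y : M) : Prop :=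
  ((stableSet f x ∩ K) ∩ (unstableSet f y ∩ K)).Nonempty ∧
    ((stableSet f y ∩ K) ∩ (unstableSet f x ∩ K)).Nonempty

/-- The closure of the class for `∼` of a periodic point `p`. -/
def piece (f : M ≃ M) (K : Set M) (p : M) : Set M :=
  closure {x | x ∈ periodicIn f K ∧ Related f K p x}

/-- The spectral decomposition: its elements, the basic sets, are the unions of the orbits under
`f` of the closures of the classes of periodic points for `∼`. -/
def basicSets (f : M ≃ M) (K : Set M) : Set (Set M) :=
  {B | ∃ p ∈ periodicIn f K, B = ⋃ n : ℕ, f^[n] '' piece f K p}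

/-- The trace on `K` of the stable set of `B`: the points `x` of `K` with `d(f^n(x), B) → 0` as
`n → +∞`. -/
def stableTrace (f : M ≃ M) (K B : Set M) : Set M :=
  {x | x ∈ K ∧ Tendsto (fun n : ℕ => Metric.infDist (f^[n] x) B) atTop (𝓝 0)}

/-- The trace on `K` of the unstable set of `B`. -/
def unstableTrace (f : M ≃ M) (K B : Set M) : Set M := stableTrace f.symm K B

/-- The relation `A ≻ B`. -/
def Succ (f : M ≃ M) (K A B : Set M) : Prop :=
  ((unstableTrace f K A \ A) ∩ (stableTrace f K B \ B)).Nonempty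

end Metric

section Manifold

variable {E : Type*} [NormedAddCommGroup E] [NormedSpace ℝ E]
  {M : Type*} [MetricSpace M] [ChartedSpace E M]

/-- The vectors tangent at `z` to a subset `S` of `M`: the velocities at time `0` of the `C^1`
curves through `z` that stay in `S` for small times. If `S` is an embedded `C^1` submanifold
and `z ∈ S`, this is the tangent space of `S` at `z`. (The tangent spaces at the equal points `γ 0`
and `z` are the same, with underlying vector space `E`.) -/
def tangentVectors (E : Type*) [NormedAddCommGroup E] [NormedSpace ℝ E]
    {M : Type*} [MetricSpace M] [ChartedSpace E M] (S : Set M) (z : M) :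
    Set (TangentSpace 𝓘(ℝ, E) z) :=
  {v | ∃ γ : ℝ → M, γ 0 = z ∧ ContMDiffAt 𝓘(ℝ, ℝ) 𝓘(ℝ, E) 1 γ 0 ∧
    (∀ᶠ t in 𝓝 (0 : ℝ), γ t ∈ S) ∧
    @Eq E (mfderiv 𝓘(ℝ, ℝ) 𝓘(ℝ, E) γ 0 (1 : ℝ)) v}

/-- `S` and `T` are transverse: at each common point `z`, `T_z S + T_z T = T_z M`. -/
def Transverse (E : Type*) [NormedAddCommGroup E] [NormedSpace ℝ E]
    {M : Type*} [MetricSpace M] [ChartedSpace E M] (S T : Set M) : Prop :=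
  ∀ z ∈ S ∩ T,
    Submodule.span ℝ (tangentVectors E S z) ⊔ Submodule.span ℝ (tangentVectors E T z) = ⊤

/-- The compact set `L` is hyperbolic for `f`: it is invariant and the tangent bundle over `L`
splits into two `Tf`-invariant subbundles (one of which may be zero), the first contracted by `f`
and the second contracted by `f⁻¹`. -/
def IsHyperbolic [RiemannianBundle (fun x : M => TangentSpace 𝓘(ℝ, E) x)]
    (f : M ≃ₘ^1⟮𝓘(ℝ, E), 𝓘(ℝ, E)⟯ M) (L : Set M) : Prop :=
  IsCompact L ∧ f '' L = L ∧
  ∃ Es Eu : (x : M) → Submodule ℝ (TangentSpace 𝓘(ℝ, E) x),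
    (∀ x ∈ L, IsCompl (Es x) (Eu x)) ∧
    (∀ x ∈ L, (Es x).map (mfderiv 𝓘(ℝ, E) 𝓘(ℝ, E) f x).toLinearMap = Es (f x)) ∧
    (∀ x ∈ L, (Eu x).map (mfderiv 𝓘(ℝ, E) 𝓘(ℝ, E) f x).toLinearMap = Eu (f x)) ∧
    ∃ C lam : ℝ, 0 < C ∧ 0 < lam ∧ lam < 1 ∧
      (∀ x ∈ L, ∀ v ∈ Es x, ∀ n : ℕ,
        ‖mfderiv 𝓘(ℝ, E) 𝓘(ℝ, E) (f^[n]) x v‖ ≤ C * lam ^ n * ‖v‖) ∧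
      (∀ x ∈ L, ∀ v ∈ Eu x, ∀ n : ℕ,
        ‖mfderiv 𝓘(ℝ, E) 𝓘(ℝ, E) (f.symm^[n]) x v‖ ≤ C * lam ^ n * ‖v‖)

/-- `K` is an `AS` compact subset for the diffeomorphism `f`. Smallness of `ε` is what makes the
sets `W^s_ε(x)` and `W^u_ε(y)`, for `x` and `y` in `K`, local stable and unstable manifolds. -/
structure IsAS [RiemannianBundle (fun x : M => TangentSpace 𝓘(ℝ, E) x)]
    (f : M ≃ₘ^1⟮𝓘(ℝ, E), 𝓘(ℝ, E)⟯ M) (K : Set M) : Prop where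
  isCompact : IsCompact K
  invariant : f '' K = K
  hyperbolic : IsHyperbolic f (nonwandering f.toEquiv K)
  periodic_dense : nonwandering f.toEquiv K = closure (periodicIn f.toEquiv K)
  transverse : ∃ ε₀ : ℝ, 0 < ε₀ ∧ ∀ ε : ℝ, 0 < ε → ε ≤ ε₀ → ∀ x ∈ K, ∀ y ∈ K,
    Transverse E (localStable f.toEquiv ε x) (localUnstable f.toEquiv ε y) ∧
      localStable f.toEquiv ε x ∩ localUnstable f.toEquiv ε y ⊆ K

end Manifold

end ASCompact

/-!
The proof avoids the stable manifold theorem and rests on two uses of compactness, in a finite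
family of charts covering `K`.

*Hyperbolicity of the nonwandering set.* Over a hyperbolic set, a tangent orbit that is bounded in
the past and in the future vanishes. By compactness, the distance of two orbits that stay close to
the nonwandering set and to each other is at any time at most half of what it is at some time of a
window of fixed length (`IsHyperbolic.exists_window`). Since the orbits of `K` converge to the
nonwandering set, two orbits that stay close in the future are asymptotic at an exponential rate
(`exists_decay`). Hence small local stable sets lie in the stable sets, and the vectors tangent to
them are contracted by the iterates of `f`.

*Transversality.* By the previous point and transversality at each `x ∈ K` of its own local stable
and unstable sets, the tangent space at `x` is spanned by vectors contracted in the future and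
vectors contracted in the past. A bounded orbit of the dual cocycle annihilates both, hence vanishes
(`IsAS.dual_eq_zero`), and by compactness this persists, with a uniform bound, along pseudo-orbits
of `K` (`IsAS.exists_dual_bound`). By duality, the linearized equation of the orbits near a
pseudo-orbit is solvable with a bound in `ℓ¹` that does not depend on its length, so that the Graves
surjectivity theorem gives true orbits near the pseudo-orbits with one small jump. By the second
half of the `AS` condition these orbits lie in `K`: if `x, y ∈ K` are close, the local stable set of
`x` meets the local unstable set of `y` in `K` (`IsAS.exists_bracket`).

*No cycles.* What remains is topological. Say that `x` leads to `y` if there are orbits of `K` that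
follow arbitrarily closely the past of `x` and later the future of `y`. The local product structure
makes this relation transitive. A periodic point `p` and the points of its basic set lead to each
other, and a connection from `A` to `B` makes the periodic points of `A` lead to those of `B`. If a
point `z` belongs to a connection from `A` to `B` that is part of a cycle, then `f z` leads to `z`,
so that `z` is nonwandering, hence a limit of periodic points; as its orbit converges to `B`, the
homoclinic relation between periodic points shows that `z ∈ B` (`HasLocalProduct.mem_basicSet`),
which is excluded. So the reflexive transitive closure of the relation `≻` is a partial order, and
it extends to a total order.
-/

namespace ASCompact

/-! ### Finite families of charts around a compact set -/

section ChartMap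

variable {E : Type*} [NormedAddCommGroup E] [NormedSpace ℝ E]
  {M : Type*} [MetricSpace M] [ChartedSpace E M]

/-- The map `f` read in the chart at `p` (in the source) and the chart at `q` (in the target). -/
noncomputable def chartMap (f : M ≃ₘ^1⟮𝓘(ℝ, E), 𝓘(ℝ, E)⟯ M) (p q : M) : E → E :=
  extChartAt 𝓘(ℝ, E) q ∘ f ∘ (extChartAt 𝓘(ℝ, E) p).symm

/-- The derivative of `f` at `x` read in the charts at `p` and `q`. It is meaningful if `x` is in
the domain of the chart at `p` and `f x` in the domain of the chart at `q`. -/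
noncomputable def chartDeriv (f : M ≃ₘ^1⟮𝓘(ℝ, E), 𝓘(ℝ, E)⟯ M) (p q x : M) : E →L[ℝ] E :=
  fderiv ℝ (chartMap f p q) (extChartAt 𝓘(ℝ, E) p x)

lemma chartMap_extChartAt (f : M ≃ₘ^1⟮𝓘(ℝ, E), 𝓘(ℝ, E)⟯ M) {p x : M} (q : M)
    (hp : x ∈ (chartAt E p).source) :
    chartMap f p q (extChartAt 𝓘(ℝ, E) p x) = extChartAt 𝓘(ℝ, E) q (f x) := by
  have : (extChartAt 𝓘(ℝ, E) p).symm (extChartAt 𝓘(ℝ, E) p x) = x :=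
    (extChartAt 𝓘(ℝ, E) p).left_inv (by simpa using hp)
  simp only [chartMap, Function.comp_apply, this]

variable [IsManifold 𝓘(ℝ, E) 1 M]

lemma hasStrictFDerivAt_chartMap (f : M ≃ₘ^1⟮𝓘(ℝ, E), 𝓘(ℝ, E)⟯ M) {p q x : M}
    (hp : x ∈ (chartAt E p).source) (hq : f x ∈ (chartAt E q).source) :
    HasStrictFDerivAt (chartMap f p q) (chartDeriv f p q x) (extChartAt 𝓘(ℝ, E) p x) := by
  have h := ((contMDiffAt_iff_of_mem_source hp hq).1 (f.contMDiff x)).2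
  simp only [modelWithCornersSelf_coe, range_id, contDiffWithinAt_univ] at h
  exact h.hasStrictFDerivAt one_ne_zero

lemma continuousAt_chartDeriv (f : M ≃ₘ^1⟮𝓘(ℝ, E), 𝓘(ℝ, E)⟯ M) {p q x : M}
    (hp : x ∈ (chartAt E p).source) (hq : f x ∈ (chartAt E q).source) :
    ContinuousAt (chartDeriv f p q) x := by
  have h := ((contMDiffAt_iff_of_mem_source hp hq).1 (f.contMDiff x)).2
  simp only [modelWithCornersSelf_coe, range_id, contDiffWithinAt_univ] at h
  have h1 : ContinuousAt (fderiv ℝ (chartMap f p q)) (extChartAt 𝓘(ℝ, E) p x) :=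
    (h.fderiv_right (m := 0) (by simp)).continuousAt
  exact ContinuousAt.comp (f := extChartAt 𝓘(ℝ, E) p) h1
    (continuousAt_extChartAt' (by simpa using hp))

lemma chartDeriv_mfderiv (f : M ≃ₘ^1⟮𝓘(ℝ, E), 𝓘(ℝ, E)⟯ M) {p q x : M}
    (hp : x ∈ (chartAt E p).source) (hq : f x ∈ (chartAt E q).source)
    (v : TangentSpace 𝓘(ℝ, E) x) :
    chartDeriv f p q x (mfderiv 𝓘(ℝ, E) 𝓘(ℝ, E) (extChartAt 𝓘(ℝ, E) p) x v) =
      mfderiv 𝓘(ℝ, E) 𝓘(ℝ, E) (extChartAt 𝓘(ℝ, E) q) (f x)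
        (mfderiv 𝓘(ℝ, E) 𝓘(ℝ, E) f x v) := by
  have hf : MDifferentiableAt 𝓘(ℝ, E) 𝓘(ℝ, E) f x := f.mdifferentiable one_ne_zero x
  have hφ := mdifferentiableAt_extChartAt (I := 𝓘(ℝ, E)) hp
  have hφ' := mdifferentiableAt_extChartAt (I := 𝓘(ℝ, E)) hq
  have hF := (hasStrictFDerivAt_chartMap f hp hq).hasFDerivAt.hasMFDerivAt
  have h1 := HasMFDerivAt.comp x hF hφ.hasMFDerivAt
  have h2 := HasMFDerivAt.comp x hφ'.hasMFDerivAt hf.hasMFDerivAt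
  have heq : chartMap f p q ∘ extChartAt 𝓘(ℝ, E) p =ᶠ[𝓝 x] extChartAt 𝓘(ℝ, E) q ∘ f := by
    filter_upwards [(chartAt E p).open_source.mem_nhds hp] with y hy
    exact chartMap_extChartAt f q hy
  have h3 := hasMFDerivAt_unique (h1.congr_of_eventuallyEq heq.symm) h2
  exact congrArg (fun T : E →L[ℝ] E => T v) h3

lemma chartDeriv_chartDeriv_symm (f : M ≃ₘ^1⟮𝓘(ℝ, E), 𝓘(ℝ, E)⟯ M) {p q x y : M} (hxy : f x = y)
    (hp : x ∈ (chartAt E p).source) (hq : y ∈ (chartAt E q).source) (u : E) :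
    chartDeriv f p q x (chartDeriv f.symm q p y u) = u := by
  have hyx : f.symm y = x := by rw [← hxy]; exact f.symm_apply_apply x
  have h1 := (hasStrictFDerivAt_chartMap f hp (q := q) (hxy ▸ hq)).hasFDerivAt
  have h2 := (hasStrictFDerivAt_chartMap f.symm hq (q := p) (hyx ▸ hp)).hasFDerivAt
  have hx' : chartMap f.symm q p (extChartAt 𝓘(ℝ, E) q y) = extChartAt 𝓘(ℝ, E) p x := by
    rw [chartMap_extChartAt _ _ hq, hyx]
  rw [← hx'] at h1
  have h3 := h1.comp _ h2
  have hc : ContinuousAt (fun e => f.symm ((extChartAt 𝓘(ℝ, E) q).symm e))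
      (extChartAt 𝓘(ℝ, E) q y) :=
    f.symm.continuous.continuousAt.comp (continuousAt_extChartAt_symm' (by simpa using hq))
  have hl : (extChartAt 𝓘(ℝ, E) q).symm (extChartAt 𝓘(ℝ, E) q y) = y :=
    (extChartAt 𝓘(ℝ, E) q).left_inv (by simpa using hq)
  have heq : chartMap f p q ∘ chartMap f.symm q p =ᶠ[𝓝 (extChartAt 𝓘(ℝ, E) q y)] id := by
    have ht : (extChartAt 𝓘(ℝ, E) q).target ∈ 𝓝 (extChartAt 𝓘(ℝ, E) q y) :=
      extChartAt_target_mem_nhds' ((extChartAt 𝓘(ℝ, E) q).map_source (by simpa using hq))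
    have hs : ∀ᶠ e in 𝓝 (extChartAt 𝓘(ℝ, E) q y),
        f.symm ((extChartAt 𝓘(ℝ, E) q).symm e) ∈ (chartAt E p).source := by
      refine hc.eventually ((chartAt E p).open_source.mem_nhds ?_)
      simpa only [hl, hyx] using hp
    filter_upwards [ht, hs] with e he he'
    have h4 : chartMap f.symm q p e =
        extChartAt 𝓘(ℝ, E) p (f.symm ((extChartAt 𝓘(ℝ, E) q).symm e)) := rfl
    rw [Function.comp_apply, h4, chartMap_extChartAt f q he', f.apply_symm_apply,
      (extChartAt 𝓘(ℝ, E) q).right_inv he, id]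
  have h5 := (h3.congr_of_eventuallyEq heq.symm).unique (hasFDerivAt_id _)
  exact congrArg (fun T : E →L[ℝ] E => T u) h5

lemma mfderiv_extChartAt_bijective {p x : M} (hp : x ∈ (chartAt E p).source) :
    Function.Bijective (mfderiv 𝓘(ℝ, E) 𝓘(ℝ, E) (extChartAt 𝓘(ℝ, E) p) x) :=
  (isInvertible_mfderiv_extChartAt (I := 𝓘(ℝ, E)) (by simpa using hp)).bijective

end ChartMap

section ChartCover

variable (E : Type*) [NormedAddCommGroup E] [NormedSpace ℝ E]
  {M : Type*} [MetricSpace M] [ChartedSpace E M]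
  [RiemannianBundle (fun x : M => TangentSpace 𝓘(ℝ, E) x)]

/-- A finite family of charts covering the compact set `K`: `centers` lists the points whose
preferred charts are used, and the compact sets `dom p ⊆ K`, contained in the chart domains,
cover `K`. Over `dom p`, the Riemannian norm is at most `const` times the norm of `E` in the chart
at `p`. -/
structure ChartCover (K : Set M) where
  centers : Set M
  finite_centers : centers.Finite
  dom : M → Set M
  isCompact_dom : ∀ p ∈ centers, IsCompact (dom p)
  dom_subset_source : ∀ p ∈ centers, dom p ⊆ (chartAt E p).source
  dom_subset : ∀ p ∈ centers, dom p ⊆ K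
  cover : ∀ x ∈ K, ∃ p ∈ centers, x ∈ dom p
  const : ℝ
  norm_le : ∀ p ∈ centers, ∀ x ∈ dom p, ∀ w : TangentSpace 𝓘(ℝ, E) x,
    ‖w‖ ≤ const * @norm E _ (mfderiv 𝓘(ℝ, E) 𝓘(ℝ, E) (extChartAt 𝓘(ℝ, E) p) x w)

lemma exists_chartCover [FiniteDimensional ℝ E] [IsManifold 𝓘(ℝ, E) 1 M]
    [IsContinuousRiemannianBundle E (fun x : M => TangentSpace 𝓘(ℝ, E) x)]
    {K : Set M} (hK : IsCompact K) : Nonempty (ChartCover E K) := by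
  have : LocallyCompactSpace M := ChartedSpace.locallyCompactSpace E M
  have key : ∀ p : M, ∃ V : Set M, V ∈ 𝓝 p ∧ IsCompact V ∧ V ⊆ (chartAt E p).source ∧
      ∃ C : ℝ, ∀ x ∈ V, ∀ w : TangentSpace 𝓘(ℝ, E) x,
        ‖w‖ ≤ C * @norm E _ (mfderiv 𝓘(ℝ, E) 𝓘(ℝ, E) (extChartAt 𝓘(ℝ, E) p) x w) := by
    intro p
    obtain ⟨C, hC0, hC⟩ := eventually_norm_mfderivWithin_symm_extChartAt_comp_lt 𝓘(ℝ, E) p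
    obtain ⟨V, hV, hVs, hVc⟩ := local_compact_nhds (x := p)
      (inter_mem hC ((chartAt E p).open_source.mem_nhds (mem_chart_source E p)))
    refine ⟨V, hV, hVc, fun x hx => (hVs hx).2, C, fun x hx w => ?_⟩
    have h1 := (hVs hx).1
    have hx' : x ∈ (extChartAt 𝓘(ℝ, E) p).source := by simpa using (hVs hx).2
    have h2 := mfderivWithin_extChartAt_symm_comp_mfderiv_extChartAt' (I := 𝓘(ℝ, E)) hx'
    let _ := normedAddCommGroupTangentSpaceVectorSpace (extChartAt 𝓘(ℝ, E) p x)
    let _ := normedSpaceTangentSpaceVectorSpace (extChartAt 𝓘(ℝ, E) p x)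
    have h3 := (mfderivWithin 𝓘(ℝ, E) 𝓘(ℝ, E) (extChartAt 𝓘(ℝ, E) p).symm (range 𝓘(ℝ, E))
      (extChartAt 𝓘(ℝ, E) p x)).le_of_opNorm_le h1.le
      (mfderiv 𝓘(ℝ, E) 𝓘(ℝ, E) (extChartAt 𝓘(ℝ, E) p) x w)
    have h4 := congrArg (fun T : E →L[ℝ] E => T w) h2
    -- The norm of a vector of `E` depends on its base point, which is rewritten separately.
    have h5 : ∀ y : M, y = x → ∀ w' : E, w' = w →
        @norm (TangentSpace 𝓘(ℝ, E) x) _ w = @norm (TangentSpace 𝓘(ℝ, E) y) _ w' := by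
      rintro y rfl w' rfl; rfl
    exact (h5 _ ((extChartAt 𝓘(ℝ, E) p).left_inv hx') _ h4).trans_le h3
  choose V hV hVc hVs C hC using key
  obtain ⟨t, ht, htK⟩ := hK.elim_nhds_subcover V (fun x _ => hV x)
  refine ⟨⟨t, t.finite_toSet, fun p => V p ∩ K, fun p _ => (hVc p).inter hK,
    fun p _ x hx => hVs p hx.1, fun p _ => inter_subset_right, fun x hx => ?_,
    ∑ p ∈ t, |C p|, fun p hp x hx w => ?_⟩⟩
  · obtain ⟨p, hp, hxp⟩ := mem_iUnion₂.1 (htK hx)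
    exact ⟨p, hp, hxp, hx⟩
  · refine (hC p x hx.1 w).trans (mul_le_mul_of_nonneg_right ?_ (norm_nonneg _))
    exact (le_abs_self _).trans (Finset.single_le_sum (f := fun p => |C p|)
      (fun _ _ => abs_nonneg _) hp)

variable {E} {K : Set M}

/-- The chart at `p` belongs to the family and may be used at `x`. -/
def ChartCover.Adapted (c : ChartCover E K) (p x : M) : Prop := p ∈ c.centers ∧ x ∈ c.dom p

lemma ChartCover.Adapted.mem_source {c : ChartCover E K} {p x : M} (h : c.Adapted p x) :
    x ∈ (chartAt E p).source := c.dom_subset_source p h.1 h.2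

lemma ChartCover.Adapted.mem {c : ChartCover E K} {p x : M} (h : c.Adapted p x) : x ∈ K :=
  c.dom_subset p h.1 h.2

/-- A sequence of points with adapted charts has a limit with an adapted chart along any
ultrafilter. -/
lemma ChartCover.exists_limit (c : ChartCover E K) (U : Ultrafilter ℕ) {p x : ℕ → M}
    (h : ∀ m, c.Adapted (p m) (x m)) :
    ∃ p' x', c.Adapted p' x' ∧ (∀ᶠ m in U, p m = p') ∧ Tendsto x U (𝓝 x') := by
  obtain ⟨p', hp', hU⟩ := (Ultrafilter.eventually_exists_mem_iff (f := U)
    (P := fun a m => p m = a) c.finite_centers).1 (Eventually.of_forall fun m => ⟨_, (h m).1, rfl⟩)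
  have h1 : c.dom p' ∈ (U.map x) := by
    rw [Ultrafilter.mem_map]
    filter_upwards [hU] with m hm
    exact hm ▸ (h m).2
  obtain ⟨x', hx', hx⟩ := (c.isCompact_dom p' hp').ultrafilter_le_nhds' _ h1
  exact ⟨p', x', ⟨hp', hx'⟩, hU, hx⟩

end ChartCover

/-! ### Bounded tangent orbits over a hyperbolic set -/

section Hyperbolic

variable {E : Type*} [NormedAddCommGroup E] [NormedSpace ℝ E]
  {M : Type*} [MetricSpace M] [ChartedSpace E M]

section Norm

variable [RiemannianBundle (fun x : M => TangentSpace 𝓘(ℝ, E) x)]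

/-- The Riemannian norm of the vector of `T_x M` with underlying vector `v`. Separating the vector
from its base point makes it possible to rewrite the latter. -/
noncomputable def riemNorm (x : M) (v : E) : ℝ := @norm (TangentSpace 𝓘(ℝ, E) x) _ v

lemma riemNorm_nonneg (x : M) (v : E) : 0 ≤ riemNorm x v :=
  norm_nonneg (E := TangentSpace 𝓘(ℝ, E) x) v

lemma riemNorm_sub_le (x : M) (v w : E) : riemNorm x (v - w) ≤ riemNorm x v + riemNorm x w :=
  norm_sub_le (E := TangentSpace 𝓘(ℝ, E) x) v w

lemma eq_zero_of_riemNorm_le_zero {x : M} {v : E} (h : riemNorm x v ≤ 0) : v = 0 :=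
  norm_le_zero_iff (E := TangentSpace 𝓘(ℝ, E) x).1 h

end Norm

lemma iterate_eq_of_succ {X : Type*} {g : X → X} {z : ℕ → X} (hz : ∀ n, z (n + 1) = g (z n))
    (n : ℕ) :
    g^[n] (z 0) = z n := by
  induction n with
  | zero => rfl
  | succ n ih => rw [Function.iterate_succ_apply', ih, hz]

/-- The vector `w n` is the image of `w 0` under the derivative of `g^[n]`, if every `w (n + 1)` is
the image of `w n` under the derivative of `g`. -/
lemma mfderiv_iterate_eq {g : M → M} (hg : MDifferentiable 𝓘(ℝ, E) 𝓘(ℝ, E) g) {z : ℕ → M}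
    (hz : ∀ n, z (n + 1) = g (z n)) {w : ℕ → E}
    (hw : ∀ n, w (n + 1) = mfderiv 𝓘(ℝ, E) 𝓘(ℝ, E) g (z n) (w n)) (n : ℕ) :
    HasMFDerivAt 𝓘(ℝ, E) 𝓘(ℝ, E) (g^[n]) (z 0) (mfderiv 𝓘(ℝ, E) 𝓘(ℝ, E) (g^[n]) (z 0)) ∧
    @Eq E (mfderiv 𝓘(ℝ, E) 𝓘(ℝ, E) (g^[n]) (z 0) (w 0)) (w n) := by
  induction n with
  | zero =>
    have h := hasMFDerivAt_id (I := 𝓘(ℝ, E)) (z 0)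
    have h' : HasMFDerivAt 𝓘(ℝ, E) 𝓘(ℝ, E) (g^[0]) (z 0) _ := h
    refine ⟨h'.mdifferentiableAt.hasMFDerivAt, ?_⟩
    exact congrArg (fun T : E →L[ℝ] E => T (w 0)) h'.mfderiv
  | succ n ih =>
    have h1 : HasMFDerivAt 𝓘(ℝ, E) 𝓘(ℝ, E) g (g^[n] (z 0)) _ := (hg _).hasMFDerivAt
    have h2 := HasMFDerivAt.comp (z 0) h1 ih.1
    rw [← Function.iterate_succ'] at h2
    refine ⟨h2.mdifferentiableAt.hasMFDerivAt, ?_⟩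
    have h3 := congrArg (fun T : E →L[ℝ] E => T (w 0)) h2.mfderiv
    refine h3.trans ?_
    have h4 : ∀ y : M, y = z n → ∀ v : E, v = w n →
        @Eq E (mfderiv 𝓘(ℝ, E) 𝓘(ℝ, E) g y v) (w (n + 1)) := by
      rintro y rfl v rfl; exact (hw n).symm
    exact h4 _ (iterate_eq_of_succ hz n) _ ih.2

lemma riemNorm_le_of_iterate [RiemannianBundle (fun x : M => TangentSpace 𝓘(ℝ, E) x)]
    {g : M → M} (hg : MDifferentiable 𝓘(ℝ, E) 𝓘(ℝ, E) g) {z : ℕ → M}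
    (hz : ∀ n, z (n + 1) = g (z n)) {w : ℕ → E}
    (hw : ∀ n, w (n + 1) = mfderiv 𝓘(ℝ, E) 𝓘(ℝ, E) g (z n) (w n)) {n : ℕ} {B : ℝ}
    (h : @norm (TangentSpace 𝓘(ℝ, E) (g^[n] (z 0))) _
      (mfderiv 𝓘(ℝ, E) 𝓘(ℝ, E) (g^[n]) (z 0) (w 0)) ≤
        B * @norm (TangentSpace 𝓘(ℝ, E) (z 0)) _ (w 0)) :
    riemNorm (z n) (w n) ≤ B * riemNorm (z 0) (w 0) := by
  rw [← (mfderiv_iterate_eq hg hz hw n).2, ← iterate_eq_of_succ hz n]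
  exact h

lemma mfderiv_mfderiv_symm (f : M ≃ₘ^1⟮𝓘(ℝ, E), 𝓘(ℝ, E)⟯ M) {x y : M} (hxy : f x = y) (v : E) :
    @Eq E (mfderiv 𝓘(ℝ, E) 𝓘(ℝ, E) f.symm y (mfderiv 𝓘(ℝ, E) 𝓘(ℝ, E) f x v)) v := by
  subst hxy
  have h1 : HasMFDerivAt 𝓘(ℝ, E) 𝓘(ℝ, E) f x _ := (f.mdifferentiable one_ne_zero x).hasMFDerivAt
  have h2 : HasMFDerivAt 𝓘(ℝ, E) 𝓘(ℝ, E) f.symm (f x) _ :=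
    (f.symm.mdifferentiable one_ne_zero (f x)).hasMFDerivAt
  have h3 := HasMFDerivAt.comp x h2 h1
  have h4 : (f.symm : M → M) ∘ f = id := by ext z; exact f.symm_apply_apply z
  rw [h4] at h3
  exact congrArg (fun T : E →L[ℝ] E => T v) (hasMFDerivAt_unique h3 (hasMFDerivAt_id _))

variable [RiemannianBundle (fun x : M => TangentSpace 𝓘(ℝ, E) x)]
variable {f : M ≃ₘ^1⟮𝓘(ℝ, E), 𝓘(ℝ, E)⟯ M} {K L : Set M}

lemma IsHyperbolic.symm (h : IsHyperbolic f L) : IsHyperbolic f.symm L := by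
  obtain ⟨hc, hi, Es, Eu, hcompl, hs, hu, C, lam, hC, hl0, hl1, hCs, hCu⟩ := h
  have key : ∀ F : (x : M) → Submodule ℝ (TangentSpace 𝓘(ℝ, E) x),
      (∀ x ∈ L, (F x).map (mfderiv 𝓘(ℝ, E) 𝓘(ℝ, E) f x).toLinearMap = F (f x)) →
      ∀ x ∈ L, (F x).map (mfderiv 𝓘(ℝ, E) 𝓘(ℝ, E) f.symm x).toLinearMap = F (f.symm x) := by
    intro F hF x hx
    rw [← hi] at hx
    obtain ⟨y, hy, rfl⟩ := hx
    have h1 : ∀ z : M, z = y → ∀ v : E, v ∈ F (f y) →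
        (mfderiv 𝓘(ℝ, E) 𝓘(ℝ, E) f.symm (f y) v : E) ∈ F z := by
      rintro z rfl v hv
      rw [← hF z hy] at hv
      obtain ⟨w, hw, rfl⟩ := hv
      exact (mfderiv_mfderiv_symm f rfl w).symm ▸ hw
    have h2 : ∀ z : M, z = y → ∀ v : E, v ∈ F z →
        ∃ w ∈ F (f y), @Eq E (mfderiv 𝓘(ℝ, E) 𝓘(ℝ, E) f.symm (f y) w) v := by
      rintro z rfl v hv
      refine ⟨mfderiv 𝓘(ℝ, E) 𝓘(ℝ, E) f z v, ?_, mfderiv_mfderiv_symm f rfl v⟩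
      rw [← hF z hy]
      exact ⟨v, hv, rfl⟩
    ext v
    constructor
    · rintro ⟨w, hw, rfl⟩
      exact h1 _ (f.symm_apply_apply y) w hw
    · intro hv
      obtain ⟨w, hw, hwv⟩ := h2 _ (f.symm_apply_apply y) v hv
      exact ⟨w, hw, hwv⟩
  refine ⟨hc, ?_, Eu, Es, fun x hx => (hcompl x hx).symm, key Eu hu, key Es hs,
    C, lam, hC, hl0, hl1, hCu, hCs⟩
  conv_lhs => rw [← hi]
  rw [image_image]
  simp

/-- A tangent orbit over a hyperbolic set that is bounded in the past and in the future vanishes. -/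
lemma IsHyperbolic.eq_zero_of_riemNorm_le (h : IsHyperbolic f L) {x : ℤ → M}
    (hx : ∀ n, x (n + 1) = f (x n)) (hxL : ∀ n, x n ∈ L) {w : ℤ → E}
    (hw : ∀ n, w (n + 1) = mfderiv 𝓘(ℝ, E) 𝓘(ℝ, E) f (x n) (w n)) {S : ℝ}
    (hS : ∀ n, riemNorm (x n) (w n) ≤ S) : w 0 = 0 := by
  obtain ⟨hc, hi, Es, Eu, hcompl, hs, hu, C, lam, hC, hl0, hl1, hCs, hCu⟩ := h
  have hdec : ∀ n, ∃ s u : E, s ∈ Es (x n) ∧ u ∈ Eu (x n) ∧ s + u = w n := fun n => by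
    have htop : (show TangentSpace 𝓘(ℝ, E) (x n) from w n) ∈ Es (x n) ⊔ Eu (x n) := by
      rw [(hcompl _ (hxL n)).sup_eq_top]; exact Submodule.mem_top
    obtain ⟨s, hs, u, hu, h⟩ := Submodule.mem_sup.1 htop
    exact ⟨s, u, hs, hu, h⟩
  choose s u hsm hum hsu using hdec
  -- By uniqueness of the decomposition, both components are tangent orbits.
  have hsucc : ∀ n, s (n + 1) = mfderiv 𝓘(ℝ, E) 𝓘(ℝ, E) f (x n) (s n) ∧
      u (n + 1) = mfderiv 𝓘(ℝ, E) 𝓘(ℝ, E) f (x n) (u n) := by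
    intro n
    let T : E →L[ℝ] E := mfderiv 𝓘(ℝ, E) 𝓘(ℝ, E) f (x n)
    have h1 : (T (s n) : E) ∈ Es (x (n + 1)) := by
      rw [hx, ← hs _ (hxL n)]; exact ⟨s n, hsm n, rfl⟩
    have h2 : (T (u n) : E) ∈ Eu (x (n + 1)) := by
      rw [hx, ← hu _ (hxL n)]; exact ⟨u n, hum n, rfl⟩
    have h3 : T (s n) + T (u n) = s (n + 1) + u (n + 1) := by
      rw [← map_add, hsu, hsu]; exact (hw n).symm
    have h4 : T (s n) - s (n + 1) = u (n + 1) - T (u n) := by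
      rw [sub_eq_sub_iff_add_eq_add, h3, add_comm]
    have h5 : T (s n) - s (n + 1) = 0 := by
      refine Submodule.disjoint_def.1 (hcompl _ (hxL (n + 1))).disjoint (T (s n) - s (n + 1)) ?_ ?_
      · exact Submodule.sub_mem (Es (x (n + 1))) h1 (hsm (n + 1))
      · rw [h4]; exact Submodule.sub_mem (Eu (x (n + 1))) (hum (n + 1)) h2
    exact ⟨(sub_eq_zero.1 h5).symm, sub_eq_zero.1 (h4 ▸ h5)⟩
  have hsN : ∀ (k : ℤ) (n : ℕ), riemNorm (x (k + n)) (s (k + n)) ≤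
      C * lam ^ n * riemNorm (x k) (s k) := by
    intro k n
    have hz : ∀ n : ℕ, x (k + (n + 1 : ℕ)) = f (x (k + n)) := fun n => by
      rw [← hx]; push_cast; ring_nf
    have hw' : ∀ n : ℕ, s (k + (n + 1 : ℕ)) = mfderiv 𝓘(ℝ, E) 𝓘(ℝ, E) f (x (k + n)) (s (k + n)) :=
      fun n => by rw [← (hsucc _).1]; push_cast; ring_nf
    have h1 := riemNorm_le_of_iterate (f.mdifferentiable one_ne_zero)
      (z := fun n : ℕ => x (k + n)) hz
      (w := fun n : ℕ => s (k + n)) hw' (hCs _ (hxL _) _ (hsm _) n)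
    simpa only [Nat.cast_zero, add_zero] using h1
  have huN : ∀ (k : ℤ) (n : ℕ), riemNorm (x (k - n)) (u (k - n)) ≤
      C * lam ^ n * riemNorm (x k) (u k) := by
    intro k n
    have hx' : ∀ n : ℕ, x (k - n) = f (x (k - (n + 1 : ℕ))) := fun n => by
      rw [← hx]; push_cast; ring_nf
    have hz : ∀ n : ℕ, x (k - (n + 1 : ℕ)) = f.symm (x (k - n)) := fun n => by
      rw [hx' n]; exact (f.symm_apply_apply _).symm
    have hw' : ∀ n : ℕ, u (k - (n + 1 : ℕ)) =
        mfderiv 𝓘(ℝ, E) 𝓘(ℝ, E) f.symm (x (k - n)) (u (k - n)) := fun n => by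
      have h1 : u (k - n) =
          mfderiv 𝓘(ℝ, E) 𝓘(ℝ, E) f (x (k - (n + 1 : ℕ))) (u (k - (n + 1 : ℕ))) := by
        rw [← (hsucc _).2]; push_cast; ring_nf
      rw [h1]
      exact (mfderiv_mfderiv_symm f (hx' n).symm _).symm
    have h1 := riemNorm_le_of_iterate (f.symm.mdifferentiable one_ne_zero)
      (z := fun n : ℕ => x (k - n)) hz (w := fun n : ℕ => u (k - n)) hw' (hCu _ (hxL _) _ (hum _) n)
    simpa only [Nat.cast_zero, sub_zero] using h1
  have hpow : ∀ n : ℕ, lam ^ n ≤ 1 := fun n => pow_le_one₀ hl0.le hl1.le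
  have hlim : ∀ B : ℝ, Tendsto (fun n : ℕ => C * lam ^ n * B) atTop (𝓝 0) := fun B => by
    simpa using ((tendsto_pow_atTop_nhds_zero_of_lt_one hl0.le hl1).const_mul C).mul_const B
  -- Each component is bounded also in the direction in which it is not contracted.
  have hs0 : s 0 = 0 := by
    refine eq_zero_of_riemNorm_le_zero (x := x 0)
      (ge_of_tendsto' (hlim (S + C * riemNorm (x 0) (u 0))) fun n => ?_)
    have h1 := hsN (0 - n) n
    rw [sub_add_cancel] at h1
    refine h1.trans (mul_le_mul_of_nonneg_left ?_ (by positivity))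
    have h2 : s (0 - n) = w (0 - n) - u (0 - n) := eq_sub_of_add_eq (hsu _)
    rw [h2]
    refine (riemNorm_sub_le _ _ _).trans (add_le_add (hS _) ((huN 0 n).trans ?_))
    have := mul_le_mul_of_nonneg_left (hpow n) hC.le
    exact mul_le_mul_of_nonneg_right (by linarith) (riemNorm_nonneg _ _)
  have hu0 : u 0 = 0 := by
    refine eq_zero_of_riemNorm_le_zero (x := x 0)
      (ge_of_tendsto' (hlim (S + C * riemNorm (x 0) (s 0))) fun n => ?_)
    have h1 := huN (0 + n) n
    rw [add_sub_cancel_right] at h1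
    refine h1.trans (mul_le_mul_of_nonneg_left ?_ (by positivity))
    have h2 : u (0 + n) = w (0 + n) - s (0 + n) := eq_sub_of_add_eq' (hsu _)
    rw [h2]
    refine (riemNorm_sub_le _ _ _).trans (add_le_add (hS _) ((hsN 0 n).trans ?_))
    have := mul_le_mul_of_nonneg_left (hpow n) hC.le
    exact mul_le_mul_of_nonneg_right (by linarith) (riemNorm_nonneg _ _)
  rw [← hsu 0, hs0, hu0, add_zero]

variable [IsManifold 𝓘(ℝ, E) 1 M]

/-- The charts version of `IsHyperbolic.eq_zero_of_riemNorm_le`: the bound is on the coordinates. -/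
lemma IsHyperbolic.eq_zero_of_bounded (c : ChartCover E K) (h : IsHyperbolic f L) {x p : ℤ → M}
    (hx : ∀ n, x (n + 1) = f (x n)) (hxL : ∀ n, x n ∈ L) (hp : ∀ n, c.Adapted (p n) (x n))
    {u : ℤ → E} (hu : ∀ n, u (n + 1) = chartDeriv f (p n) (p (n + 1)) (x n) (u n)) {S : ℝ}
    (hS : ∀ n, ‖u n‖ ≤ S) : u 0 = 0 := by
  have hdec : ∀ n, ∃ w : E,
      @Eq E (mfderiv 𝓘(ℝ, E) 𝓘(ℝ, E) (extChartAt 𝓘(ℝ, E) (p n)) (x n) w) (u n) :=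
    fun n => (mfderiv_extChartAt_bijective (hp n).mem_source).2 (u n)
  choose w hw using hdec
  have hws : ∀ n, w (n + 1) = mfderiv 𝓘(ℝ, E) 𝓘(ℝ, E) f (x n) (w n) := fun n => by
    refine (mfderiv_extChartAt_bijective (hp (n + 1)).mem_source).1 ?_
    refine (hw (n + 1)).trans ?_
    rw [hu, ← hw]
    have h1 : f (x n) ∈ (chartAt E (p (n + 1))).source := hx n ▸ (hp (n + 1)).mem_source
    refine (chartDeriv_mfderiv f (hp n).mem_source h1 (w n)).trans ?_
    rw [hx n]
  have h0 : w 0 = 0 := by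
    refine h.eq_zero_of_riemNorm_le hx hxL hws (S := |c.const| * S) fun n => ?_
    refine (c.norm_le _ (hp n).1 _ (hp n).2 (w n)).trans ?_
    have h1 : @norm E _ (mfderiv 𝓘(ℝ, E) 𝓘(ℝ, E) (extChartAt 𝓘(ℝ, E) (p n)) (x n) (w n)) ≤ S :=
      (hw n).symm ▸ hS n
    exact mul_le_mul (le_abs_self _) h1 (norm_nonneg _) (abs_nonneg _)
  rw [← hw 0, h0]
  exact map_zero (mfderiv 𝓘(ℝ, E) 𝓘(ℝ, E) (extChartAt 𝓘(ℝ, E) (p 0)) (x 0))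

end Hyperbolic

/-! ### Orbits that stay close to each other in the future are asymptotic -/

section Orbits

variable {X : Type*}

lemma exists_orbit (f : X ≃ X) (x : X) : ∃ z : ℤ → X, z 0 = x ∧ ∀ n, z (n + 1) = f (z n) := by
  refine ⟨fun n => ((f : Equiv.Perm X) ^ n) x, by simp, fun n => ?_⟩
  change ((f : Equiv.Perm X) ^ (n + 1)) x = f (((f : Equiv.Perm X) ^ n) x)
  rw [add_comm, zpow_add, zpow_one, Equiv.Perm.mul_apply]

lemma orbit_add {f : X ≃ X} {z : ℤ → X} (hz : ∀ n, z (n + 1) = f (z n)) (k : ℤ) (n : ℕ) :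
    z (k + n) = f^[n] (z k) := by
  have h := iterate_eq_of_succ (g := f) (z := fun n : ℕ => z (k + n))
    (fun n => by rw [← hz]; push_cast; ring_nf) n
  simpa using h.symm

lemma orbit_reverse {f : X ≃ X} {z : ℤ → X} (hz : ∀ n, z (n + 1) = f (z n)) (n : ℤ) :
    z (-(n + 1)) = f.symm (z (-n)) := by
  rw [Equiv.eq_symm_apply, ← hz]
  ring_nf

lemma orbit_mem {f : X ≃ X} {K : Set X} (hK : f '' K = K) {z : ℤ → X}
    (hz : ∀ n, z (n + 1) = f (z n)) (h0 : z 0 ∈ K) (n : ℤ) : z n ∈ K := by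
  induction n using Int.induction_on with
  | zero => exact h0
  | succ n ih => rw [hz, ← hK]; exact mem_image_of_mem _ ih
  | pred n ih =>
    have h : z (-n) = f (z (-n - 1)) := by rw [← hz, sub_add_cancel]
    rw [h, ← hK] at ih
    exact (f.injective.mem_set_image).1 ih

end Orbits

/-- The forward orbit of a point of the compact set `K` converges to the nonwandering set. -/
lemma eventually_mem_thickening_nonwandering {M : Type*} [MetricSpace M] {f : M ≃ M} {K : Set M}
    (hK : IsCompact K) (hf : f '' K = K) {x : M} (hx : x ∈ K) {e : ℝ} (he : 0 < e) :
    ∀ᶠ n : ℕ in atTop, f^[n] x ∈ Metric.thickening e (nonwandering f K) := by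
  have hxK : ∀ n, f^[n] x ∈ K := fun n => by
    induction n with
    | zero => exact hx
    | succ n ih => rw [Function.iterate_succ_apply', ← hf]; exact mem_image_of_mem _ ih
  by_contra hcon
  have hfr : ∃ᶠ n : ℕ in atTop, f^[n] x ∈ K \ Metric.thickening e (nonwandering f K) :=
    (not_eventually.1 hcon).mono fun n hn => ⟨hxK n, hn⟩
  obtain ⟨a, ha, hcl⟩ :=
    (hK.diff Metric.isOpen_thickening).exists_mapClusterPt_of_frequently hfr
  refine ha.2 (Metric.self_subset_thickening he _ ⟨ha.1, fun U hU => ?_⟩)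
  have hfU := mapClusterPt_iff_frequently.1 hcl U hU
  obtain ⟨n₁, hn₁⟩ := hfU.exists
  obtain ⟨n₂, hn₂, hlt⟩ := (hfU.and_eventually (eventually_gt_atTop n₁)).exists
  refine ⟨n₂ - n₁, by omega, f^[n₁] x, ⟨hn₁, hxK _⟩, ?_⟩
  rw [← Function.iterate_add_apply, Nat.sub_add_cancel hlt.le]
  exact ⟨hn₂, hxK _⟩

/-- A bounded sequence that, from the rank `N` on, is everywhere at most half of one of its values
at distance at most `N`, decreases exponentially at a rate controlled by its first `N` terms. -/
lemma le_half_pow_mul_sum_of_window {a : ℕ → ℝ} {N : ℕ} {B : ℝ} (h0 : ∀ n, 0 ≤ a n)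
    (hB : ∀ n, a n ≤ B) (hw : ∀ n, N ≤ n → ∃ m, m ≤ n + N ∧ n ≤ m + N ∧ 2 * a n ≤ a m)
    (j n : ℕ) (hn : j * N ≤ n) : a n ≤ (1 / 2) ^ j * ∑ i ∈ Finset.range N, a i := by
  set b := ∑ i ∈ Finset.range N, a i
  have hb0 : 0 ≤ b := Finset.sum_nonneg fun i _ => h0 i
  have hb : ∀ n < N, a n ≤ b := fun n hn =>
    Finset.single_le_sum (f := a) (fun i _ => h0 i) (Finset.mem_range.2 hn)
  have hB0 : 0 ≤ B := (h0 0).trans (hB 0)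
  have h1 : ∀ (i n : ℕ), a n ≤ b + B * (1 / 2) ^ i := by
    intro i
    induction i with
    | zero => intro n; simpa using (hB n).trans (le_add_of_nonneg_left hb0)
    | succ i ih =>
      intro n
      have h2 : 0 ≤ B * (1 / 2) ^ (i + 1) := by positivity
      rcases lt_or_ge n N with hn | hn
      · linarith [hb n hn]
      · obtain ⟨m, -, -, hm⟩ := hw n hn
        have := ih m
        rw [pow_succ]
        linarith
  have h2 : ∀ n, a n ≤ b := fun n => by
    have h3 : Tendsto (fun i : ℕ => b + B * (1 / 2 : ℝ) ^ i) atTop (𝓝 (b + B * 0)) :=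
      ((tendsto_pow_atTop_nhds_zero_of_lt_one (by norm_num) (by norm_num)).const_mul B).const_add b
    rw [mul_zero, add_zero] at h3
    exact ge_of_tendsto' h3 fun i => h1 i n
  induction j generalizing n with
  | zero => simpa using h2 n
  | succ j ih =>
    have h3 : (j + 1) * N = j * N + N := by ring
    obtain ⟨m, -, hnm, hm⟩ := hw n (by rw [h3] at hn; omega)
    have := ih m (by rw [h3] at hn; omega)
    rw [pow_succ]
    linarith

section Charts

variable {E : Type*} [NormedAddCommGroup E] [NormedSpace ℝ E]
  {M : Type*} [MetricSpace M] [ChartedSpace E M]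

/-- Rescaled differences of points are transformed in the limit by the derivative, by strict
differentiability. -/
lemma tendsto_smul_chartMap_sub [IsManifold 𝓘(ℝ, E) 1 M] (f : M ≃ₘ^1⟮𝓘(ℝ, E), 𝓘(ℝ, E)⟯ M)
    {p q x : M} (hp : x ∈ (chartAt E p).source) (hq : f x ∈ (chartAt E q).source)
    {l : Filter ℕ} {a b : ℕ → E} {r : ℕ → ℝ} {u : E}
    (ha : Tendsto a l (𝓝 (extChartAt 𝓘(ℝ, E) p x)))
    (hb : Tendsto b l (𝓝 (extChartAt 𝓘(ℝ, E) p x)))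
    (hu : Tendsto (fun m => (r m)⁻¹ • (a m - b m)) l (𝓝 u)) :
    Tendsto (fun m => (r m)⁻¹ • (chartMap f p q (a m) - chartMap f p q (b m))) l
      (𝓝 (chartDeriv f p q x u)) := by
  have h1 := (hasStrictFDerivAt_chartMap f hp hq).isLittleO.comp_tendsto (ha.prodMk_nhds hb)
  have h2 := ((Asymptotics.isBigO_refl (fun m => (r m)⁻¹) l).smul_isLittleO h1).trans_isBigO
    (hu.isBigO_one ℝ)
  rw [Asymptotics.isLittleO_one_iff] at h2
  have h3 := h2.add (((chartDeriv f p q x).continuous.tendsto u).comp hu)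
  rw [zero_add] at h3
  refine h3.congr fun m => ?_
  simp only [Function.comp_apply, map_smul, ← smul_add, sub_add_cancel]

lemma tendsto_extChartAt {p x : M} (hp : x ∈ (chartAt E p).source) :
    Tendsto (extChartAt 𝓘(ℝ, E) p) (𝓝 x) (𝓝 (extChartAt 𝓘(ℝ, E) p x)) :=
  continuousAt_extChartAt' (by simpa using hp)

variable [RiemannianBundle (fun x : M => TangentSpace 𝓘(ℝ, E) x)]
  {f : M ≃ₘ^1⟮𝓘(ℝ, E), 𝓘(ℝ, E)⟯ M} {K L : Set M}

lemma tendsto_of_dist_lt {X : Type*} [PseudoMetricSpace X] {l : Filter ℕ} (hl : l ≤ atTop)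
    {x y : ℕ → X} {a : X}
    (hx : Tendsto x l (𝓝 a)) (hxy : ∀ᶠ m in l, dist (x m) (y m) < 1 / ((m : ℝ) + 1)) :
    Tendsto y l (𝓝 a) := by
  refine (tendsto_iff_of_dist ?_).1 hx
  exact squeeze_zero' (Eventually.of_forall fun _ => dist_nonneg) (hxy.mono fun _ h => h.le)
    (tendsto_one_div_add_atTop_nhds_zero_nat.mono_left hl)

lemma ChartCover.exists_adapted (c : ChartCover E K) {x : ℤ → M} (hx : ∀ n, x n ∈ K) :
    ∃ p : ℤ → M, ∀ n, c.Adapted (p n) (x n) := by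
  choose p hp using fun n => c.cover (x n) (hx n)
  exact ⟨p, hp⟩

lemma ChartCover.exists_dist_lt (c : ChartCover E K) {σ : ℝ} (hσ : 0 < σ) :
    ∃ e > 0, ∀ p x y, c.Adapted p x → dist x y < e → y ∈ (chartAt E p).source ∧
      ‖extChartAt 𝓘(ℝ, E) p y - extChartAt 𝓘(ℝ, E) p x‖ < σ := by
  by_contra! hcon
  choose p x y hp hxy hn using fun m : ℕ => hcon (1 / ((m : ℝ) + 1)) (by positivity)
  set U : Ultrafilter ℕ := hyperfilter ℕ
  obtain ⟨p', x', hpx, hp', hx'⟩ := c.exists_limit U hp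
  have hy' := tendsto_of_dist_lt Nat.hyperfilter_le_atTop hx' (Eventually.of_forall hxy)
  have h1 := (((tendsto_extChartAt hpx.mem_source).comp hy').sub
    ((tendsto_extChartAt hpx.mem_source).comp hx')).norm
  rw [sub_self, norm_zero] at h1
  obtain ⟨m, hm1, hm2, hm3⟩ := ((h1.eventually (gt_mem_nhds hσ)).and
    ((hy'.eventually ((chartAt E p').open_source.mem_nhds hpx.mem_source)).and hp')).exists
  subst hm3
  exact absurd hm1 (not_lt.2 (hn m hm2))

lemma ChartCover.exists_norm_le (c : ChartCover E K) {ε : ℝ} (hε : 0 < ε) :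
    ∃ r > 0, ∀ p x v, c.Adapted p x → ‖v‖ ≤ r →
      extChartAt 𝓘(ℝ, E) p x + v ∈ (extChartAt 𝓘(ℝ, E) p).target ∧
      dist x ((extChartAt 𝓘(ℝ, E) p).symm (extChartAt 𝓘(ℝ, E) p x + v)) < ε := by
  by_contra! hcon
  choose p x v hp hv hn using fun m : ℕ => hcon (1 / ((m : ℝ) + 1)) (by positivity)
  set U : Ultrafilter ℕ := hyperfilter ℕ
  obtain ⟨p', x', hpx, hp', hx'⟩ := c.exists_limit U hp
  have hv' : Tendsto v U (𝓝 0) := squeeze_zero_norm hv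
    (tendsto_one_div_add_atTop_nhds_zero_nat.mono_left Nat.hyperfilter_le_atTop)
  have h1 := ((tendsto_extChartAt hpx.mem_source).comp hx').add hv'
  rw [add_zero] at h1
  have hs : x' ∈ (extChartAt 𝓘(ℝ, E) p').source := by simpa using hpx.mem_source
  have h2 := h1.eventually (extChartAt_target_mem_nhds' ((extChartAt 𝓘(ℝ, E) p').map_source hs))
  have h3 := hx'.dist ((continuousAt_extChartAt_symm' hs).tendsto.comp h1)
  rw [(extChartAt 𝓘(ℝ, E) p').left_inv hs, dist_self] at h3
  obtain ⟨m, hm1, hm2, hm3⟩ := ((h3.eventually (gt_mem_nhds hε)).and (h2.and hp')).exists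
  subst hm3
  exact absurd hm1 (not_lt.2 (hn m hm2))

variable [FiniteDimensional ℝ E] [IsManifold 𝓘(ℝ, E) 1 M]

/-- Over a neighbourhood of a hyperbolic set, the distance in the charts of two nearby orbits is at
any time at most half of what it is at some other time of a window of fixed length: otherwise
rescaled differences would converge to a nonzero bounded tangent orbit. -/
lemma IsHyperbolic.exists_window (c : ChartCover E K) (hL : IsHyperbolic f L) :
    ∃ N : ℕ, ∃ e > 0, ∀ x y p : ℤ → M, (∀ n, x (n + 1) = f (x n)) → (∀ n, y (n + 1) = f (y n)) →
      (∀ n, c.Adapted (p n) (x n)) → ∀ k : ℤ,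
      (∀ n : ℤ, |n - k| ≤ N → x n ∈ Metric.thickening e L ∧ dist (x n) (y n) < e) →
      ∃ n : ℤ, |n - k| ≤ N ∧
        2 * ‖extChartAt 𝓘(ℝ, E) (p k) (y k) - extChartAt 𝓘(ℝ, E) (p k) (x k)‖ ≤
          ‖extChartAt 𝓘(ℝ, E) (p n) (y n) - extChartAt 𝓘(ℝ, E) (p n) (x n)‖ := by
  suffices h : ∃ N : ℕ, ∃ e > 0, ∀ x y p : ℤ → M, (∀ n, x (n + 1) = f (x n)) →
      (∀ n, y (n + 1) = f (y n)) → (∀ n, c.Adapted (p n) (x n)) →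
      (∀ n : ℤ, |n| ≤ N → x n ∈ Metric.thickening e L ∧ dist (x n) (y n) < e) →
      ∃ n : ℤ, |n| ≤ N ∧
        2 * ‖extChartAt 𝓘(ℝ, E) (p 0) (y 0) - extChartAt 𝓘(ℝ, E) (p 0) (x 0)‖ ≤
          ‖extChartAt 𝓘(ℝ, E) (p n) (y n) - extChartAt 𝓘(ℝ, E) (p n) (x n)‖ by
    obtain ⟨N, e, he, h⟩ := h
    refine ⟨N, e, he, fun x y p hx hy hp k hk => ?_⟩
    obtain ⟨n, hn, h2⟩ := h (fun n => x (k + n)) (fun n => y (k + n)) (fun n => p (k + n))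
      (fun n => by rw [← add_assoc, hx]) (fun n => by rw [← add_assoc, hy]) (fun n => hp _)
      (fun n hn => hk (k + n) (by simpa using hn))
    exact ⟨k + n, by simpa using hn, by simpa using h2⟩
  by_contra! hcon
  choose x y p hx hy hp hc hn using fun m : ℕ => hcon m (1 / ((m : ℝ) + 1)) (by positivity)
  set U : Ultrafilter ℕ := hyperfilter ℕ
  have hU : (U : Filter ℕ) ≤ atTop := Nat.hyperfilter_le_atTop
  have hwin : ∀ n : ℤ, ∀ᶠ m : ℕ in U, |n| ≤ m := fun n => by
    filter_upwards [hU (eventually_ge_atTop n.natAbs)] with m hm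
    rw [Int.abs_eq_natAbs]; exact_mod_cast hm
  choose p' x' hpx hp' hx' using fun n : ℤ => c.exists_limit U (fun m => hp m n)
  have hy' : ∀ n, Tendsto (fun m => y m n) U (𝓝 (x' n)) := fun n =>
    tendsto_of_dist_lt hU (hx' n) ((hwin n).mono fun m hm => (hc m n hm).2)
  have hxf : ∀ n, x' (n + 1) = f (x' n) := fun n => by
    refine tendsto_nhds_unique (hx' (n + 1)) ?_
    simp only [hx]
    exact (f.continuous.tendsto _).comp (hx' n)
  have hxL : ∀ n, x' n ∈ L := fun n => by
    rw [← hL.1.isClosed.closure_eq, Metric.closure_eq_iInter_cthickening]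
    refine mem_iInter₂.2 fun e he => ?_
    refine Metric.isClosed_cthickening.mem_of_tendsto (hx' n) ?_
    filter_upwards [hwin n, hU (tendsto_one_div_add_atTop_nhds_zero_nat.eventually
      (gt_mem_nhds he))] with m hm hme
    exact Metric.thickening_subset_cthickening _ _ (Metric.thickening_mono hme.le _ (hc m n hm).1)
  -- The differences in the charts, rescaled so as to have norm one at time zero.
  set a : ℕ → ℤ → E := fun m n =>
    extChartAt 𝓘(ℝ, E) (p m n) (y m n) - extChartAt 𝓘(ℝ, E) (p m n) (x m n) with ha
  have hr : ∀ m, 0 < ‖a m 0‖ := fun m => by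
    have := hn m 0 (by simp)
    simp only [ha]
    linarith
  have hub : ∀ (m : ℕ) (n : ℤ), |n| ≤ m → ‖‖a m 0‖⁻¹ • a m n‖ ≤ 2 := fun m n h => by
    rw [norm_smul, norm_inv, norm_norm, inv_mul_le_iff₀ (hr m), mul_comm]
    exact (hn m n h).le
  have hlim : ∀ n : ℤ, ∃ u : E, ‖u‖ ≤ 2 ∧ Tendsto (fun m => ‖a m 0‖⁻¹ • a m n) U (𝓝 u) := by
    intro n
    have h1 : Metric.closedBall (0 : E) 2 ∈ U.map (fun m => ‖a m 0‖⁻¹ • a m n) := by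
      rw [Ultrafilter.mem_map]
      filter_upwards [hwin n] with m hm
      simpa using hub m n hm
    obtain ⟨u, hu, hlim⟩ := (isCompact_closedBall (0 : E) 2).ultrafilter_le_nhds' _ h1
    exact ⟨u, by simpa using hu, hlim⟩
  choose u hu2 hu using hlim
  have husucc : ∀ n, u (n + 1) = chartDeriv f (p' n) (p' (n + 1)) (x' n) (u n) := by
    intro n
    have hs := (hpx n).mem_source
    have hs' : f (x' n) ∈ (chartAt E (p' (n + 1))).source := hxf n ▸ (hpx (n + 1)).mem_source
    have h1 : Tendsto (fun m => ‖a m 0‖⁻¹ • (extChartAt 𝓘(ℝ, E) (p' n) (y m n) -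
        extChartAt 𝓘(ℝ, E) (p' n) (x m n))) U (𝓝 (u n)) :=
      (hu n).congr' (by filter_upwards [hp' n] with m hm; simp only [ha, hm])
    have h2 := tendsto_smul_chartMap_sub f hs hs' ((tendsto_extChartAt hs).comp (hy' n))
      ((tendsto_extChartAt hs).comp (hx' n)) h1
    refine tendsto_nhds_unique (hu (n + 1)) (h2.congr' ?_)
    have ho := (chartAt E (p' n)).open_source.mem_nhds hs
    filter_upwards [hp' (n + 1), (hx' n).eventually ho, (hy' n).eventually ho] with m h3 h4 h5
    simp only [Function.comp_apply, ha, h3, chartMap_extChartAt f _ h4, chartMap_extChartAt f _ h5,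
      hx, hy]
  have h0 := hL.eq_zero_of_bounded c hxf hxL hpx husucc hu2
  have h1 : Tendsto (fun m => ‖‖a m 0‖⁻¹ • a m 0‖) U (𝓝 ‖u 0‖) := (hu 0).norm
  have h2 : ∀ m, ‖‖a m 0‖⁻¹ • a m 0‖ = 1 := fun m => by
    rw [norm_smul, norm_inv, norm_norm, inv_mul_cancel₀ (hr m).ne']
  simp only [h2] at h1
  have h3 := tendsto_nhds_unique h1 tendsto_const_nhds
  rw [h0, norm_zero] at h3
  exact zero_ne_one h3

/-- Orbits that stay close to an orbit of `K` in the future approach it exponentially in the charts,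
with a control of the distances by finitely many of them. -/
lemma exists_decay (c : ChartCover E K) (hK : IsCompact K) (hf : f '' K = K)
    (hL : IsHyperbolic f (nonwandering f.toEquiv K)) :
    ∃ N : ℕ, ∃ e > 0, ∀ x p : ℤ → M, (∀ n, x (n + 1) = f (x n)) →
      (∀ n, c.Adapted (p n) (x n)) → ∃ n₀ : ℕ, ∀ y : ℤ → M, (∀ n, y (n + 1) = f (y n)) →
      (∀ n : ℕ, dist (x n) (y n) < e) → (∀ n : ℕ, y n ∈ (chartAt E (p n)).source) ∧
      ∀ j n : ℕ, n₀ + j * N ≤ n →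
      ‖extChartAt 𝓘(ℝ, E) (p n) (y n) - extChartAt 𝓘(ℝ, E) (p n) (x n)‖ ≤
        (1 / 2) ^ j * ∑ i ∈ Finset.range N, ‖extChartAt 𝓘(ℝ, E) (p (n₀ + i : ℕ)) (y (n₀ + i : ℕ)) -
          extChartAt 𝓘(ℝ, E) (p (n₀ + i : ℕ)) (x (n₀ + i : ℕ))‖ := by
  obtain ⟨N, e₁, he₁, hwin⟩ := hL.exists_window c
  obtain ⟨e₂, he₂, hclose⟩ := c.exists_dist_lt one_pos
  refine ⟨N, min e₁ e₂, lt_min he₁ he₂, fun x p hx hp => ?_⟩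
  obtain ⟨n₀, hn₀⟩ := eventually_atTop.1 (eventually_mem_thickening_nonwandering
    (f := f.toEquiv) hK hf (hp 0).mem he₁)
  have hthick : ∀ n : ℤ, n₀ ≤ n → x n ∈ Metric.thickening e₁ (nonwandering f.toEquiv K) := by
    intro n hn
    lift n to ℕ using by omega
    have h1 := hn₀ n (by exact_mod_cast hn)
    rwa [← orbit_add (f := f.toEquiv) hx 0 n, zero_add] at h1
  refine ⟨n₀, fun y hy hd => ⟨fun n => (hclose _ _ _ (hp n) ((hd n).trans_le (min_le_right _ _))).1,
    fun j n hn => ?_⟩⟩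
  set a : ℕ → ℝ := fun i => ‖extChartAt 𝓘(ℝ, E) (p (n₀ + i : ℕ)) (y (n₀ + i : ℕ)) -
    extChartAt 𝓘(ℝ, E) (p (n₀ + i : ℕ)) (x (n₀ + i : ℕ))‖ with ha
  have h1 := le_half_pow_mul_sum_of_window (a := a) (N := N) (B := 1) (fun _ => norm_nonneg _)
    (fun i => ((hclose _ _ _ (hp _) ((hd _).trans_le (min_le_right _ _))).2).le)
    (fun i hi => ?_) j (n - n₀) (by omega)
  · have h2 : n₀ + (n - n₀) = n := by omega
    simpa only [ha, h2] using h1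
  · obtain ⟨k, hk, hle⟩ := hwin x y p hx hy hp (n₀ + i : ℕ) (fun k hk => by
      rw [abs_le] at hk
      lift k to ℕ using by omega
      exact ⟨hthick _ (by omega), (hd k).trans_le (min_le_left _ _)⟩)
    rw [abs_le] at hk
    lift k to ℕ using by omega
    refine ⟨k - n₀, by omega, by omega, ?_⟩
    have h2 : n₀ + (k - n₀) = k := by omega
    simpa only [ha, h2] using hle

lemma tendsto_zero_of_le_half_pow {a : ℕ → ℝ} {n₀ N : ℕ} {b : ℝ} (h0 : ∀ n, 0 ≤ a n)
    (h : ∀ j n : ℕ, n₀ + j * N ≤ n → a n ≤ (1 / 2) ^ j * b) : Tendsto a atTop (𝓝 0) := by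
  refine Metric.tendsto_atTop.2 fun ε hε => ?_
  have h1 : Tendsto (fun j : ℕ => (1 / 2 : ℝ) ^ j * b) atTop (𝓝 (0 * b)) :=
    (tendsto_pow_atTop_nhds_zero_of_lt_one (by norm_num) (by norm_num)).mul_const b
  rw [zero_mul] at h1
  obtain ⟨j, hj⟩ := (h1.eventually (gt_mem_nhds hε)).exists
  refine ⟨n₀ + j * N, fun n hn => ?_⟩
  rw [Real.dist_eq, sub_zero, abs_of_nonneg (h0 n)]
  exact (h j n hn).trans_lt hj

variable [IsContinuousRiemannianBundle E (fun x : M => TangentSpace 𝓘(ℝ, E) x)]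

/-- Orbits that stay close to an orbit of `K` in the future are asymptotic to it. -/
lemma exists_localStable_subset_stableSet (hK : IsCompact K) (hf : f '' K = K)
    (hL : IsHyperbolic f (nonwandering f.toEquiv K)) :
    ∃ e > 0, ∀ x ∈ K, localStable f.toEquiv e x ⊆ stableSet f.toEquiv x := by
  obtain ⟨c⟩ := exists_chartCover (E := E) hK
  obtain ⟨N, e, he, hdecay⟩ := exists_decay c hK hf hL
  refine ⟨e, he, fun x hxK y hxy => ?_⟩
  obtain ⟨X, rfl, hX⟩ := exists_orbit f.toEquiv x
  obtain ⟨Y, rfl, hY⟩ := exists_orbit f.toEquiv y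
  obtain ⟨p, hp⟩ := c.exists_adapted (orbit_mem (f := f.toEquiv) hf hX hxK)
  have hXn : ∀ n : ℕ, f.toEquiv^[n] (X 0) = X n := fun n => by rw [← orbit_add hX, zero_add]
  have hYn : ∀ n : ℕ, f.toEquiv^[n] (Y 0) = Y n := fun n => by rw [← orbit_add hY, zero_add]
  obtain ⟨n₀, h1⟩ := hdecay X p hX hp
  obtain ⟨hs, h2⟩ := h1 Y hY fun n => by
    rw [← hXn, ← hYn]; exact hxy n
  have h3 := tendsto_zero_of_le_half_pow (fun n => norm_nonneg _) h2
  refine Metric.tendsto_atTop.2 fun ε hε => ?_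
  obtain ⟨r, hr, hclose⟩ := c.exists_norm_le hε
  obtain ⟨n₁, hn₁⟩ := eventually_atTop.1 (h3.eventually (gt_mem_nhds hr))
  refine ⟨n₁, fun n hn => ?_⟩
  have h4 := (hclose _ _ _ (hp n) (hn₁ n hn).le).2
  rw [add_sub_cancel, (extChartAt 𝓘(ℝ, E) (p n)).left_inv (by simpa using hs n)] at h4
  rwa [Real.dist_eq, sub_zero, abs_of_nonneg dist_nonneg, hXn, hYn]

omit [IsContinuousRiemannianBundle E (fun x : M => TangentSpace 𝓘(ℝ, E) x)] in
/-- A tangent vector of a small local stable set is contracted by the iterates of `f`. -/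
lemma exists_tendsto_zero_of_mem_tangentVectors (c : ChartCover E K) (hK : IsCompact K)
    (hf : f '' K = K) (hL : IsHyperbolic f (nonwandering f.toEquiv K)) :
    ∃ e > 0, ∀ x p : ℤ → M, (∀ n, x (n + 1) = f (x n)) → (∀ n, c.Adapted (p n) (x n)) →
      ∀ v ∈ tangentVectors E (localStable f.toEquiv e (x 0)) (x 0), ∃ u : ℕ → E,
      u 0 = mfderiv 𝓘(ℝ, E) 𝓘(ℝ, E) (extChartAt 𝓘(ℝ, E) (p 0)) (x 0) v ∧
      (∀ n : ℕ, u (n + 1) = chartDeriv f (p n) (p (n + 1)) (x n) (u n)) ∧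
      Tendsto u atTop (𝓝 0) := by
  obtain ⟨N, e, he, hdecay⟩ := exists_decay c hK hf hL
  refine ⟨e, he, fun x p hx hp v hv => ?_⟩
  obtain ⟨γ, hγ0, hγ, hγS, hv⟩ := hv
  obtain ⟨n₀, hn₀⟩ := hdecay x p hx hp
  let u : ℕ → E := fun n => Nat.rec
    (mfderiv 𝓘(ℝ, E) 𝓘(ℝ, E) (extChartAt 𝓘(ℝ, E) (p 0)) (x 0) v : E)
    (fun n w => chartDeriv f (p n) (p (n + 1)) (x n) w) n
  have husucc : ∀ n : ℕ, u (n + 1) = chartDeriv f (p n) (p (n + 1)) (x n) (u n) := fun n => rfl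
  refine ⟨u, rfl, husucc, ?_⟩
  choose Y hY0 hY using fun t => exists_orbit f.toEquiv (γ t)
  have hYn : ∀ t (n : ℕ), Y t n = f.toEquiv^[n] (γ t) := fun t n => by
    rw [← hY0, ← orbit_add (hY t), zero_add]
  have hxn : ∀ n : ℕ, f.toEquiv^[n] (x 0) = x n := fun n => by
    rw [← orbit_add (f := f.toEquiv) hx, zero_add]
  have hYx : ∀ n : ℕ, Y 0 n = x n := fun n => by rw [hYn, hγ0, hxn]
  have hcont : ∀ n : ℕ, ContinuousAt (fun t => Y t n) 0 := fun n => by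
    simp only [hYn]
    exact (f.continuous.iterate n).continuousAt.comp hγ.continuousAt
  -- `u n` is the velocity at time zero of the image of the curve under `f^[n]`, read in the charts.
  have hderiv : ∀ n : ℕ, HasDerivAt (fun t => extChartAt 𝓘(ℝ, E) (p n) (Y t n)) (u n) 0 := by
    intro n
    induction n with
    | zero =>
      have h1 : HasMFDerivAt 𝓘(ℝ, ℝ) 𝓘(ℝ, E) γ 0 _ :=
        (hγ.mdifferentiableAt one_ne_zero).hasMFDerivAt
      have h2 : HasMFDerivAt 𝓘(ℝ, E) 𝓘(ℝ, E) (extChartAt 𝓘(ℝ, E) (p 0)) (γ 0) _ :=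
        (mdifferentiableAt_extChartAt (I := 𝓘(ℝ, E)) (x := p 0)
          (by rw [hγ0]; exact (hp 0).mem_source)).hasMFDerivAt
      have h3 : ∀ y : M, y = x 0 → ∀ w : E, w = v →
          @Eq E (mfderiv 𝓘(ℝ, E) 𝓘(ℝ, E) (extChartAt 𝓘(ℝ, E) (p 0)) y w) (u 0) := by
        rintro y rfl w rfl; rfl
      obtain ⟨T, hT, hT1⟩ : ∃ T : ℝ →L[ℝ] E,
          HasFDerivAt (extChartAt 𝓘(ℝ, E) (p 0) ∘ γ) T 0 ∧ T 1 = u 0 :=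
        ⟨_, (HasMFDerivAt.comp 0 h2 h1).hasFDerivAt, h3 _ hγ0 _ hv⟩
      rw [← hT1]
      refine hT.hasDerivAt.congr_of_eventuallyEq (Eventually.of_forall fun t => ?_)
      simp [hY0]
    | succ n ih =>
      have hs := (hp n).mem_source
      have hs' : f (x n) ∈ (chartAt E (p (n + 1))).source := hx n ▸ (hp (n + 1)).mem_source
      have h1 := (hasStrictFDerivAt_chartMap f hs hs').hasFDerivAt
      rw [← hYx n] at h1
      have h2 := h1.comp_hasDerivAt 0 ih
      rw [hYx n, ← husucc n] at h2
      refine h2.congr_of_eventuallyEq ?_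
      have ho := (hcont n).eventually ((chartAt E (p n)).open_source.mem_nhds
        (by simpa only [hYx] using hs))
      filter_upwards [ho] with t ht
      rw [Function.comp_apply, chartMap_extChartAt f _ ht]
      have h3 := hY t n
      push_cast
      rw [h3]
      rfl
  have hslope : ∀ n : ℕ, Tendsto (fun t : ℝ => |t|⁻¹ * ‖extChartAt 𝓘(ℝ, E) (p n) (Y t n) -
      extChartAt 𝓘(ℝ, E) (p n) (x n)‖) (𝓝[≠] 0) (𝓝 ‖u n‖) := fun n => by
    have h1 := (hasDerivAt_iff_tendsto_slope.1 (hderiv n)).norm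
    refine h1.congr fun t => ?_
    rw [slope_def_module, hYx, norm_smul, norm_inv, sub_zero, Real.norm_eq_abs]
  have hlim : ∀ j n : ℕ, n₀ + j * N ≤ n →
      ‖u n‖ ≤ (1 / 2) ^ j * ∑ i ∈ Finset.range N, ‖u (n₀ + i)‖ := by
    intro j n hn
    have h1 := (tendsto_finsetSum (Finset.range N) fun i _ => hslope (n₀ + i)).const_mul
      ((1 / 2 : ℝ) ^ j)
    refine le_of_tendsto_of_tendsto (hslope n) h1 ?_
    filter_upwards [hγS.filter_mono nhdsWithin_le_nhds] with t ht
    have h2 := (hn₀ (Y t) (hY t) fun n => by rw [hYn, ← hxn]; exact ht n).2 j n hn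
    rw [← Finset.mul_sum, mul_left_comm]
    exact mul_le_mul_of_nonneg_left h2 (inv_nonneg.2 (abs_nonneg t))
  exact tendsto_zero_iff_norm_tendsto_zero.2
    (tendsto_zero_of_le_half_pow (fun n => norm_nonneg _) hlim)

end Charts

/-! ### Transversality as injectivity of the dual cocycle -/

lemma image_symm_eq {X : Type*} {f : X ≃ X} {K : Set X} (hf : f '' K = K) : f.symm '' K = K := by
  conv_lhs => rw [← hf]
  exact f.symm_image_image K

lemma nonwandering_symm {M : Type*} [MetricSpace M] (f : M ≃ M) (K : Set M) :
    nonwandering f.symm K = nonwandering f K := by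
  have key : ∀ g : M ≃ M, nonwandering g K ⊆ nonwandering g.symm K := by
    rintro g x ⟨hx, h⟩
    refine ⟨hx, fun U hU => ?_⟩
    obtain ⟨n, hn, y, hy, hy'⟩ := h U hU
    refine ⟨n, hn, g^[n] y, hy', ?_⟩
    rwa [(Function.LeftInverse.iterate g.symm_apply_apply n) y]
  exact (key f.symm).antisymm (key f)

section Dual

variable {E : Type*} [NormedAddCommGroup E] [NormedSpace ℝ E]
  {M : Type*} [MetricSpace M] [ChartedSpace E M]

lemma tangentVectors_mono {S T : Set M} (h : S ⊆ T) (z : M) :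
    tangentVectors E S z ⊆ tangentVectors E T z := by
  rintro v ⟨γ, h0, h1, h2, h3⟩
  exact ⟨γ, h0, h1, h2.mono fun t ht => h ht, h3⟩

lemma localStable_mono (f : M ≃ M) {e e' : ℝ} (h : e ≤ e') (x : M) :
    localStable f e x ⊆ localStable f e' x := fun _ hy n => (hy n).trans_le h

lemma self_mem_localStable (f : M ≃ M) {e : ℝ} (h : 0 < e) (x : M) : x ∈ localStable f e x :=
  fun n => by rwa [dist_self]

variable [FiniteDimensional ℝ E] [IsManifold 𝓘(ℝ, E) 1 M]
  [RiemannianBundle (fun x : M => TangentSpace 𝓘(ℝ, E) x)]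
  {f : M ≃ₘ^1⟮𝓘(ℝ, E), 𝓘(ℝ, E)⟯ M} {K : Set M}

/-- A bounded orbit of the dual cocycle over an orbit of `K` vanishes: it annihilates the vectors
contracted in the future and those contracted in the past, and by transversality of the local
stable and unstable sets of a point these vectors span the tangent space. -/
lemma IsAS.dual_eq_zero (h : IsAS f K) (c : ChartCover E K) {x p : ℤ → M}
    (hx : ∀ n, x (n + 1) = f (x n)) (hp : ∀ n, c.Adapted (p n) (x n)) {ψ : ℤ → E →L[ℝ] ℝ}
    (hψ : ∀ n, ψ n = (ψ (n + 1)).comp (chartDeriv f (p n) (p (n + 1)) (x n))) {S : ℝ}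
    (hS : ∀ n, ‖ψ n‖ ≤ S) : ψ 0 = 0 := by
  obtain ⟨e₀, he₀, htrans⟩ := h.transverse
  have hf' : f.symm '' K = K := image_symm_eq (f := f.toEquiv) h.invariant
  have hL' : IsHyperbolic f.symm (nonwandering f.symm.toEquiv K) := by
    have := nonwandering_symm f.toEquiv K
    exact this ▸ h.hyperbolic.symm
  obtain ⟨e₁, he₁, h1⟩ := exists_tendsto_zero_of_mem_tangentVectors c h.isCompact h.invariant
    h.hyperbolic
  obtain ⟨e₂, he₂, h2⟩ := exists_tendsto_zero_of_mem_tangentVectors c h.isCompact hf' hL'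
  have he : 0 < min e₀ (min e₁ e₂) := lt_min he₀ (lt_min he₁ he₂)
  have hspan := (htrans _ he (min_le_left _ _) (x 0) (hp 0).mem (x 0) (hp 0).mem).1 (x 0)
    ⟨self_mem_localStable _ he _, self_mem_localStable _ he _⟩
  have hlim : ∀ (u : ℕ → E) (s : ℕ → ℤ), Tendsto u atTop (𝓝 0) →
      (∀ n, ψ (s n) (u n) = ψ 0 (u 0)) → ψ 0 (u 0) = 0 := by
    intro u s hu hc
    have h3 : Tendsto (fun n => ψ (s n) (u n)) atTop (𝓝 0) := by
      refine squeeze_zero_norm (a := fun n => S * ‖u n‖)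
        (fun n => (ψ (s n)).le_of_opNorm_le (hS _) _) ?_
      simpa using hu.norm.const_mul S
    simp only [hc] at h3
    exact tendsto_nhds_unique tendsto_const_nhds h3
  let D : E →L[ℝ] E := mfderiv 𝓘(ℝ, E) 𝓘(ℝ, E) (extChartAt 𝓘(ℝ, E) (p 0)) (x 0)
  let Z : Submodule ℝ (TangentSpace 𝓘(ℝ, E) (x 0)) := ((ψ 0).comp D).toLinearMap.ker
  have hZ : (⊤ : Submodule ℝ (TangentSpace 𝓘(ℝ, E) (x 0))) ≤ Z := by
    rw [← hspan]
    refine sup_le (Submodule.span_le.2 fun v hv => ?_) (Submodule.span_le.2 fun v hv => ?_)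
    · obtain ⟨u, hu0, hu, hu'⟩ := h1 x p hx hp v (tangentVectors_mono
        (localStable_mono _ ((min_le_right _ _).trans (min_le_left _ _)) _) _ hv)
      have h3 : ∀ n : ℕ, ψ n (u n) = ψ 0 (u 0) := fun n => by
        induction n with
        | zero => rfl
        | succ n ih => rw [← ih, hψ n, hu n]; simp
      have h4 := hlim u (fun n => n) hu' h3
      rw [hu0] at h4
      exact h4
    · obtain ⟨u, hu0, hu, hu'⟩ := h2 (fun n => x (-n)) (fun n => p (-n))
        (orbit_reverse (f := f.toEquiv) hx) (fun n => hp _) v (tangentVectors_mono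
        (localStable_mono _ ((min_le_right _ _).trans (min_le_right _ _)) _) _ hv)
      have h3 : ∀ n : ℕ, ψ (-n) (u n) = ψ 0 (u 0) := fun n => by
        induction n with
        | zero => rfl
        | succ n ih =>
          have h5 : (-((n + 1 : ℕ) : ℤ)) + 1 = -n := by push_cast; ring
          have h6 : (-((n + 1 : ℕ) : ℤ)) = -(n + 1) := by push_cast; ring
          have h7 := hx (-((n + 1 : ℕ) : ℤ))
          rw [h5] at h7
          rw [← ih, hψ (-((n + 1 : ℕ) : ℤ)), h5, ContinuousLinearMap.comp_apply, hu n, ← h6]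
          rw [chartDeriv_chartDeriv_symm f h7.symm (hp _).mem_source (hp _).mem_source]
      have h4 := hlim u (fun n => -n) hu' h3
      rw [hu0] at h4
      exact h4
  ext v
  obtain ⟨w, hw⟩ := (mfderiv_extChartAt_bijective (hp 0).mem_source).2 v
  have h3 : ψ 0 (D w) = 0 := hZ (Submodule.mem_top (x := w))
  have h4 : D w = v := hw
  rw [← h4, h3]
  rfl

/-- The estimate of `IsAS.dual_eq_zero` persists for pseudo-orbits: an almost orbit of the dual
cocycle whose norm is maximal at time zero would otherwise have a nonzero limit. -/
lemma IsAS.exists_dual_bound (h : IsAS f K) (c : ChartCover E K) :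
    ∃ κ > 0, ∃ δ > 0, ∀ x p : ℤ → M, (∀ n, dist (f (x n)) (x (n + 1)) < δ) →
      (∀ n, c.Adapted (p n) (x n)) → ∀ ψ : ℤ → E →L[ℝ] ℝ, ψ 0 ≠ 0 → (∀ k, ‖ψ k‖ ≤ ‖ψ 0‖) →
      ∃ k, κ * ‖ψ 0‖ ≤
        ‖(ψ (k + 1)).comp (chartDeriv f (p k) (p (k + 1)) (x k)) - ψ k‖ := by
  by_contra! hcon
  choose x p hx hp ψ hψ0 hψ hn using fun m : ℕ =>
    hcon (1 / ((m : ℝ) + 1)) (by positivity) (1 / ((m : ℝ) + 1)) (by positivity)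
  set U : Ultrafilter ℕ := hyperfilter ℕ
  have hU : (U : Filter ℕ) ≤ atTop := Nat.hyperfilter_le_atTop
  choose p' x' hpx hp' hx' using fun n : ℤ => c.exists_limit U (fun m => hp m n)
  have hxf : ∀ n, x' (n + 1) = f (x' n) := fun n =>
    tendsto_nhds_unique (hx' (n + 1)) (tendsto_of_dist_lt hU
      ((f.continuous.tendsto _).comp (hx' n)) (Eventually.of_forall fun m => hx m n))
  have hr : ∀ m, 0 < ‖ψ m 0‖ := fun m => norm_pos_iff.2 (hψ0 m)
  have hub : ∀ m n, ‖‖ψ m 0‖⁻¹ • ψ m n‖ ≤ 1 := fun m n => by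
    rw [norm_smul, norm_inv, norm_norm, inv_mul_le_iff₀ (hr m), mul_one]
    exact hψ m n
  have : ProperSpace (E →L[ℝ] ℝ) := FiniteDimensional.proper ℝ _
  have hlim : ∀ n : ℤ, ∃ u : E →L[ℝ] ℝ, ‖u‖ ≤ 1 ∧
      Tendsto (fun m => ‖ψ m 0‖⁻¹ • ψ m n) U (𝓝 u) := by
    intro n
    obtain ⟨u, hu, hlim⟩ := (isCompact_closedBall (0 : E →L[ℝ] ℝ) 1).ultrafilter_le_nhds'
      (U.map (fun m => ‖ψ m 0‖⁻¹ • ψ m n)) (by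
        rw [Ultrafilter.mem_map]
        exact Eventually.of_forall fun m => by simpa using hub m n)
    exact ⟨u, by simpa using hu, hlim⟩
  choose u hu1 hu using hlim
  have husucc : ∀ n, u n = (u (n + 1)).comp (chartDeriv f (p' n) (p' (n + 1)) (x' n)) := by
    intro n
    have hs := (hpx n).mem_source
    have hs' : f (x' n) ∈ (chartAt E (p' (n + 1))).source := hxf n ▸ (hpx (n + 1)).mem_source
    have h1 : Tendsto (fun m => chartDeriv f (p m n) (p m (n + 1)) (x m n)) U
        (𝓝 (chartDeriv f (p' n) (p' (n + 1)) (x' n))) := by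
      refine ((continuousAt_chartDeriv f hs hs').tendsto.comp (hx' n)).congr' ?_
      filter_upwards [hp' n, hp' (n + 1)] with m h3 h4
      simp only [Function.comp_apply, h3, h4]
    have h2 := (((continuous_fst.clm_comp continuous_snd).tendsto
      (u (n + 1), chartDeriv f (p' n) (p' (n + 1)) (x' n))).comp
        ((hu (n + 1)).prodMk_nhds h1)).sub (hu n)
    have h3 : Tendsto (fun m => (‖ψ m 0‖⁻¹ • ψ m (n + 1)).comp
        (chartDeriv f (p m n) (p m (n + 1)) (x m n)) - ‖ψ m 0‖⁻¹ • ψ m n) U (𝓝 0) := by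
      refine squeeze_zero_norm (a := fun m : ℕ => 1 / ((m : ℝ) + 1)) (fun m => ?_)
        (tendsto_one_div_add_atTop_nhds_zero_nat.mono_left hU)
      have h4 : (‖ψ m 0‖⁻¹ • ψ m (n + 1)).comp (chartDeriv f (p m n) (p m (n + 1)) (x m n)) -
          ‖ψ m 0‖⁻¹ • ψ m n = ‖ψ m 0‖⁻¹ •
            ((ψ m (n + 1)).comp (chartDeriv f (p m n) (p m (n + 1)) (x m n)) - ψ m n) := by
        ext v; simp [mul_sub]
      rw [h4, norm_smul, norm_inv, norm_norm,
        inv_mul_le_iff₀ (hr m), mul_comm]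
      exact (hn m n).le
    exact (sub_eq_zero.1 (tendsto_nhds_unique h2 h3)).symm
  have h0 := h.dual_eq_zero c hxf hpx husucc hu1
  have h1 : Tendsto (fun m => ‖‖ψ m 0‖⁻¹ • ψ m 0‖) U (𝓝 ‖u 0‖) := (hu 0).norm
  have h2 : ∀ m, ‖‖ψ m 0‖⁻¹ • ψ m 0‖ = 1 := fun m => by
    rw [norm_smul, norm_inv, norm_norm, inv_mul_cancel₀ (hr m).ne']
  simp only [h2] at h1
  have h3 := tendsto_nhds_unique h1 tendsto_const_nhds
  rw [h0, norm_zero] at h3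
  exact zero_ne_one h3

end Dual

/-! ### Shadowing and the local product structure -/

/-- A linear map whose transpose is bounded below by `κ` has a right inverse bounded by `κ⁻¹`. -/
lemma exists_nonlinearRightInverse {X Y : Type*} [NormedAddCommGroup X] [NormedSpace ℝ X]
    [FiniteDimensional ℝ X] [NormedAddCommGroup Y] [NormedSpace ℝ Y] (T : X →L[ℝ] Y) {κ : ℝ}
    (hκ : 0 < κ) (h : ∀ φ : Y →L[ℝ] ℝ, κ * ‖φ‖ ≤ ‖φ.comp T‖) :
    ∃ R : T.NonlinearRightInverse, (R.nnnorm : ℝ) = κ⁻¹ := by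
  have hball : ∀ y : Y, ‖y‖ ≤ κ → ∃ x : X, ‖x‖ ≤ 1 ∧ T x = y := by
    intro y hy
    by_contra! hcon
    have : ProperSpace X := FiniteDimensional.proper ℝ X
    have hcomp : IsCompact (T '' Metric.closedBall 0 1) :=
      (isCompact_closedBall (0 : X) 1).image T.continuous
    have hconv : Convex ℝ (T '' Metric.closedBall 0 1) :=
      (convex_closedBall (0 : X) 1).linear_image T.toLinearMap
    obtain ⟨φ, s, hs, hy'⟩ := geometric_hahn_banach_closed_point hconv hcomp.isClosed
      (fun hmem => by
        obtain ⟨x, hx, hxy⟩ := hmem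
        exact hcon x (by simpa using hx) hxy : y ∉ T '' Metric.closedBall 0 1)
    have hle : ∀ x : X, ‖x‖ ≤ 1 → φ (T x) < s := fun x hx => hs _ ⟨x, by simpa using hx, rfl⟩
    have hs0 : 0 < s := by simpa using hle 0 (by simp)
    have h1 : ‖φ.comp T‖ ≤ s := by
      refine ContinuousLinearMap.opNorm_le_of_unit_norm hs0.le fun x hx => ?_
      rw [Real.norm_eq_abs, abs_le]
      have h2 := hle x hx.le
      have h3 := hle (-x) (by rw [norm_neg, hx])
      simp only [map_neg] at h3
      exact ⟨by simp only [ContinuousLinearMap.comp_apply]; linarith, h2.le⟩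
    have h2 : φ y ≤ ‖φ‖ * ‖y‖ := (le_abs_self _).trans (φ.le_opNorm y)
    have h3 := mul_le_mul_of_nonneg_left hy (norm_nonneg φ)
    have h4 := h φ
    linarith
  have hall : ∀ y : Y, ∃ x : X, ‖x‖ ≤ κ⁻¹ * ‖y‖ ∧ T x = y := by
    intro y
    rcases eq_or_ne y 0 with rfl | hy
    · exact ⟨0, by simp⟩
    have hy0 : 0 < ‖y‖ := norm_pos_iff.2 hy
    obtain ⟨x, hx, hxy⟩ := hball ((κ / ‖y‖) • y) (by
      rw [norm_smul, Real.norm_of_nonneg (by positivity), div_mul_cancel₀ _ hy0.ne'])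
    refine ⟨(‖y‖ / κ) • x, ?_, ?_⟩
    · rw [norm_smul, Real.norm_of_nonneg (by positivity), div_eq_inv_mul]
      exact mul_le_of_le_one_right (by positivity) hx
    · rw [map_smul, hxy, smul_smul, div_mul_div_comm, mul_comm, div_self (by positivity), one_smul]
  choose R hR hTR using hall
  exact ⟨⟨R, ⟨κ⁻¹, by positivity⟩, hR, hTR⟩, rfl⟩

section Sequences

variable {E : Type*} [NormedAddCommGroup E] [NormedSpace ℝ E] [FiniteDimensional ℝ E]

/-- The inclusion of `E` as the factor of index `k` of the `ℓ¹` product of `n` copies of `E`; it is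
zero if `k` is not in `[0, n)`. -/
noncomputable def slot (E : Type*) [NormedAddCommGroup E] [NormedSpace ℝ E]
    [FiniteDimensional ℝ E] (n : ℕ) (k : ℤ) : E →L[ℝ] PiLp 1 (fun _ : Fin n => E) :=
  LinearMap.toContinuousLinearMap
    { toFun := fun v => WithLp.toLp 1 fun i => if ((i : ℕ) : ℤ) = k then v else 0
      map_add' := fun v w => by ext i; by_cases h : ((i : ℕ) : ℤ) = k <;> simp [h]
      map_smul' := fun a v => by ext i; by_cases h : ((i : ℕ) : ℤ) = k <;> simp [h] }

lemma slot_apply (n : ℕ) (k : ℤ) (v : E) (i : Fin n) :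
    slot E n k v i = if ((i : ℕ) : ℤ) = k then v else 0 := rfl

omit [NormedSpace ℝ E] [FiniteDimensional ℝ E] in
lemma norm_eq_sum_of_one {n : ℕ} (v : PiLp 1 (fun _ : Fin n => E)) : ‖v‖ = ∑ i, ‖v i‖ := by
  simp [PiLp.norm_eq_sum (p := 1) (by simp)]

lemma norm_slot_le (n : ℕ) (k : ℤ) (v : E) : ‖slot E n k v‖ ≤ ‖v‖ := by
  rw [norm_eq_sum_of_one]
  by_cases h : ∃ i : Fin n, ((i : ℕ) : ℤ) = k
  · obtain ⟨i, hi⟩ := h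
    rw [Finset.sum_eq_single i]
    · simp [slot_apply, hi]
    · intro j _ hj
      have : ((j : ℕ) : ℤ) ≠ k := fun h => hj (by ext; omega)
      simp [slot_apply, this]
    · simp
  · push Not at h
    simp [slot_apply, h]

lemma sum_slot {n : ℕ} (w : PiLp 1 (fun _ : Fin n => E)) :
    ∑ k : Fin n, slot E n (k : ℕ) (w k) = w := by
  ext i
  rw [WithLp.ofLp_sum, Finset.sum_apply, Finset.sum_eq_single i]
  · simp [slot_apply]
  · intro j _ hj
    have : ((i : ℕ) : ℤ) ≠ (j : ℕ) := fun h => hj (by ext; omega)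
    simp [slot_apply, this]
  · simp

/-- The linearization `v ↦ (A_k v_k - v_{k+1})_k` of the equation of the orbits of length `n`. -/
noncomputable def orbitOp (A : ℤ → E →L[ℝ] E) (n : ℕ) :
    PiLp 1 (fun _ : Fin (n + 1) => E) →L[ℝ] PiLp 1 (fun _ : Fin n => E) :=
  LinearMap.toContinuousLinearMap
    { toFun := fun v => WithLp.toLp 1 fun i => A (i : ℕ) (v i.castSucc) - v i.succ
      map_add' := fun v w => by ext i; simp; abel
      map_smul' := fun a v => by ext i; simp [smul_sub] }

lemma orbitOp_apply (A : ℤ → E →L[ℝ] E) (n : ℕ) (v : PiLp 1 (fun _ : Fin (n + 1) => E))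
    (i : Fin n) : orbitOp A n v i = A (i : ℕ) (v i.castSucc) - v i.succ := rfl

lemma orbitOp_slot (A : ℤ → E →L[ℝ] E) (n : ℕ) (k : ℤ) (v : E) :
    orbitOp A n (slot E (n + 1) k v) = slot E n k (A k v) - slot E n (k - 1) v := by
  ext i
  have h : ((i : ℕ) : ℤ) + 1 = k ↔ ((i : ℕ) : ℤ) = k - 1 := by omega
  simp only [orbitOp_apply, PiLp.sub_apply, slot_apply, Fin.val_castSucc, Fin.val_succ,
    Nat.cast_add, Nat.cast_one, h]
  by_cases h' : ((i : ℕ) : ℤ) = k <;> simp [h']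

/-- If the dual cocycle has no almost orbits, the linearized orbit equation can be solved with a
bound on the `ℓ¹` norm of the solution that does not depend on the length. -/
lemma exists_orbitOp_rightInverse {A : ℤ → E →L[ℝ] E} {κ : ℝ} (hκ : 0 < κ)
    (h : ∀ (ψ : ℤ → E →L[ℝ] ℝ) (k₀ : ℤ), ψ k₀ ≠ 0 → (∀ k, ‖ψ k‖ ≤ ‖ψ k₀‖) →
      ∃ k, κ * ‖ψ k₀‖ ≤ ‖(ψ (k + 1)).comp (A k) - ψ k‖) (n : ℕ) :
    ∃ R : (orbitOp A n).NonlinearRightInverse, (R.nnnorm : ℝ) = κ⁻¹ := by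
  refine exists_nonlinearRightInverse _ hκ fun φ => ?_
  rcases eq_or_ne φ 0 with rfl | hφ
  · simp
  set ψ : ℤ → E →L[ℝ] ℝ := fun k => φ.comp (slot E n (k - 1)) with hψ
  have hne : (Finset.univ : Finset (Fin n)).Nonempty := by
    rw [Finset.univ_nonempty_iff]
    by_contra hemp
    rw [not_nonempty_iff] at hemp
    refine hφ (ContinuousLinearMap.ext fun w => ?_)
    rw [← sum_slot w]
    simp
  obtain ⟨i₀, -, hi₀⟩ := Finset.exists_max_image Finset.univ
    (fun i : Fin n => ‖ψ ((i : ℕ) + 1 : ℤ)‖) hne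
  have hφle : ‖φ‖ ≤ ‖ψ ((i₀ : ℕ) + 1 : ℤ)‖ := by
    refine φ.opNorm_le_bound (norm_nonneg _) fun w => ?_
    conv_lhs => rw [← sum_slot w]
    rw [map_sum, norm_eq_sum_of_one, Finset.mul_sum]
    refine (norm_sum_le _ _).trans (Finset.sum_le_sum fun i _ => ?_)
    have h1 : φ (slot E n (i : ℕ) (w i)) = ψ ((i : ℕ) + 1 : ℤ) (w i) := by simp [hψ]
    rw [h1]
    exact (ψ _).le_of_opNorm_le (hi₀ i (Finset.mem_univ i)) _
  have hmax : ∀ k, ‖ψ k‖ ≤ ‖ψ ((i₀ : ℕ) + 1 : ℤ)‖ := by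
    intro k
    by_cases hk : ∃ i : Fin n, ((i : ℕ) : ℤ) = k - 1
    · obtain ⟨i, hi⟩ := hk
      have h1 : k = (i : ℕ) + 1 := by omega
      rw [h1]
      exact hi₀ i (Finset.mem_univ i)
    · push Not at hk
      have h1 : ψ k = 0 := by
        have h2 : slot E n (k - 1) = 0 := by ext v i; simp [slot_apply, hk]
        simp [hψ, h2]
      rw [h1, norm_zero]
      exact norm_nonneg _
  have hψ0 : ψ ((i₀ : ℕ) + 1 : ℤ) ≠ 0 := norm_pos_iff.1 ((norm_pos_iff.2 hφ).trans_le hφle)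
  obtain ⟨k, hk⟩ := h ψ _ hψ0 hmax
  refine (mul_le_mul_of_nonneg_left hφle hκ.le).trans (hk.trans ?_)
  refine ContinuousLinearMap.opNorm_le_bound _ (norm_nonneg _) fun v => ?_
  have h1 : ((ψ (k + 1)).comp (A k) - ψ k) v = φ.comp (orbitOp A n) (slot E (n + 1) k v) := by
    simp [hψ, orbitOp_slot]
  rw [h1]
  exact (ContinuousLinearMap.le_opNorm _ _).trans
    (mul_le_mul_of_nonneg_left (norm_slot_le _ _ _) (norm_nonneg _))

end Sequences

section Shadowing

variable {E : Type*} [NormedAddCommGroup E] [NormedSpace ℝ E]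
  {M : Type*} [MetricSpace M] [ChartedSpace E M] [IsManifold 𝓘(ℝ, E) 1 M]
  [RiemannianBundle (fun x : M => TangentSpace 𝓘(ℝ, E) x)]
  {f : M ≃ₘ^1⟮𝓘(ℝ, E), 𝓘(ℝ, E)⟯ M} {K : Set M}

variable (f) in
/-- Strict differentiability of `f` in the charts, uniformly over `K`. -/
lemma ChartCover.exists_approx (c : ChartCover E K) {η : ℝ} (hη : 0 < η) :
    ∃ r > 0, ∀ p q x x', c.Adapted p x → c.Adapted q x' → dist (f x) x' < r → ∀ v v',
      ‖v‖ ≤ r → ‖v'‖ ≤ r →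
      ‖chartMap f p q (extChartAt 𝓘(ℝ, E) p x + v) - chartMap f p q (extChartAt 𝓘(ℝ, E) p x + v') -
        chartDeriv f p q x (v - v')‖ ≤ η * ‖v - v'‖ := by
  by_contra! hcon
  choose p q x y hp hq hxy v w hv hw hn using fun m : ℕ => hcon (1 / ((m : ℝ) + 1)) (by positivity)
  set U : Ultrafilter ℕ := hyperfilter ℕ
  have hU : (U : Filter ℕ) ≤ atTop := Nat.hyperfilter_le_atTop
  obtain ⟨p', x', hpx, hp', hx'⟩ := c.exists_limit U hp
  obtain ⟨q', y', hqy, hq', hy'⟩ := c.exists_limit U hq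
  have hxy' : f x' = y' := tendsto_nhds_unique (tendsto_of_dist_lt hU
    ((f.continuous.tendsto _).comp hx') (Eventually.of_forall hxy)) hy'
  have hs := hpx.mem_source
  have hs' : f x' ∈ (chartAt E q').source := hxy' ▸ hqy.mem_source
  have hz : ∀ u : ℕ → E, (∀ m : ℕ, ‖u m‖ ≤ 1 / ((m : ℝ) + 1)) →
      Tendsto (fun m => extChartAt 𝓘(ℝ, E) p' (x m) + u m) U (𝓝 (extChartAt 𝓘(ℝ, E) p' x')) := by
    intro u hu
    have h1 : Tendsto u U (𝓝 0) := squeeze_zero_norm hu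
      (tendsto_one_div_add_atTop_nhds_zero_nat.mono_left hU)
    simpa using ((tendsto_extChartAt hs).comp hx').add h1
  have h1 := ((hasStrictFDerivAt_chartMap f hs hs').isLittleO.comp_tendsto
    ((hz v hv).prodMk_nhds (hz w hw))).def (half_pos hη)
  have h2 := (((continuousAt_chartDeriv f hs hs').tendsto.comp hx').sub_const
    (chartDeriv f p' q' x')).norm
  rw [sub_self, norm_zero] at h2
  obtain ⟨m, hm1, hm2, rfl, rfl⟩ := (h1.and ((h2.eventually (gt_mem_nhds (half_pos hη))).and
    (hp'.and hq'))).exists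
  refine absurd (hn m) (not_lt.2 ?_)
  simp only [Function.comp_apply, add_sub_add_left_eq_sub] at hm1 hm2
  have h3 := ContinuousLinearMap.le_of_opNorm_le _ hm2.le (v m - w m)
  rw [sub_apply] at h3
  have h4 := norm_sub_le_norm_sub_add_norm_sub
    (chartMap f (p m) (q m) (extChartAt 𝓘(ℝ, E) (p m) (x m) + v m) -
      chartMap f (p m) (q m) (extChartAt 𝓘(ℝ, E) (p m) (x m) + w m))
    (chartDeriv f (p m) (q m) x' (v m - w m)) (chartDeriv f (p m) (q m) (x m) (v m - w m))
  rw [norm_sub_rev (chartDeriv f (p m) (q m) x' (v m - w m))] at h4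
  linarith

variable [FiniteDimensional ℝ E]

/-- A pseudo-orbit of `K` with a single small jump is shadowed, over any bounded time interval, by
an orbit of the manifold. -/
lemma IsAS.exists_finite_shadow (h : IsAS f K) (c : ChartCover E K) {ε : ℝ} (hε : 0 < ε) :
    ∃ δ > 0, ∀ x p : ℤ → M, (∀ n, c.Adapted (p n) (x n)) →
      (∀ n, dist (f (x n)) (x (n + 1)) < δ) → (∃ k₀, ∀ n, n ≠ k₀ → f (x n) = x (n + 1)) →
      ∀ n : ℕ, ∃ y, ∀ k : ℕ, k ≤ n → dist (x k) (f^[k] y) < ε := by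
  obtain ⟨κ, hκ, δ₁, hδ₁, hdual⟩ := h.exists_dual_bound c
  obtain ⟨r₁, hr₁, happ⟩ := c.exists_approx f (half_pos hκ)
  obtain ⟨e₁, he₁, hsrc⟩ := c.exists_dist_lt one_pos
  obtain ⟨e₂, he₂, hfc⟩ := Metric.mem_uniformity_dist.1
    (h.isCompact.uniformContinuousAt_of_continuousAt f (fun a _ => f.continuous.continuousAt)
      (Metric.dist_mem_uniformity (half_pos he₁)))
  obtain ⟨r₂, hr₂, hball⟩ := c.exists_norm_le (lt_min hε he₂)
  set r := min r₁ r₂ with hr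
  have hr0 : 0 < r := lt_min hr₁ hr₂
  obtain ⟨e₃, he₃, hjump⟩ := c.exists_dist_lt (mul_pos (half_pos hκ) hr0)
  refine ⟨min (min δ₁ r₁) (min (e₁ / 2) e₃), by positivity, fun x p hp hx ⟨k₀, hk₀⟩ n => ?_⟩
  simp only [lt_min_iff] at hx
  set ξ : ℤ → E := fun k => extChartAt 𝓘(ℝ, E) (p k) (x k) with hξ
  set A : ℤ → E →L[ℝ] E := fun k => chartDeriv f (p k) (p (k + 1)) (x k) with hA
  obtain ⟨R, hR⟩ := exists_orbitOp_rightInverse (A := A) hκ (fun ψ k₀ h0 hmax => by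
    obtain ⟨k, hk⟩ := hdual (fun k => x (k₀ + k)) (fun k => p (k₀ + k))
      (fun k => by rw [← add_assoc]; exact (hx _).1.1) (fun k => hp _) (fun k => ψ (k₀ + k))
      (by simpa using h0) (by simpa using fun k => hmax (k₀ + k))
    refine ⟨k₀ + k, ?_⟩
    simpa only [hA, add_zero, add_assoc] using hk) n
  -- The zeros of `G` are the displacements from the pseudo-orbit to true orbits, in the charts.
  set G : PiLp 1 (fun _ : Fin (n + 1) => E) → PiLp 1 (fun _ : Fin n => E) := fun v =>
    WithLp.toLp 1 fun i => chartMap f (p (i : ℕ)) (p ((i : ℕ) + 1)) (ξ (i : ℕ) + v i.castSucc) -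
      (ξ ((i : ℕ) + 1) + v i.succ) with hG
  obtain ⟨η, hη⟩ : ∃ η : NNReal, (η : ℝ) = κ / 2 := ⟨⟨κ / 2, by positivity⟩, rfl⟩
  have hGapp : ApproximatesLinearOn G (orbitOp A n) (Metric.closedBall 0 r) η := by
    intro v hv w hw
    rw [mem_closedBall_zero_iff] at hv hw
    have hle : ∀ u : PiLp 1 (fun _ : Fin (n + 1) => E), ‖u‖ ≤ r → ∀ i, ‖u i‖ ≤ r₁ :=
      fun u hu i => (PiLp.norm_apply_le u i).trans (hu.trans (min_le_left _ _))
    rw [norm_eq_sum_of_one, norm_eq_sum_of_one, hη, Finset.mul_sum, Fin.sum_univ_castSucc]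
    refine le_add_of_le_of_nonneg (Finset.sum_le_sum fun i _ => ?_) (by positivity)
    have h1 := happ _ _ _ _ (hp (i : ℕ)) (hp ((i : ℕ) + 1)) (hx _).1.2 (v i.castSucc) (w i.castSucc)
      (hle v hv _) (hle w hw _)
    refine (le_of_eq ?_).trans h1
    congr 1
    simp only [PiLp.sub_apply, orbitOp_apply, hG, hA, hξ]
    abel
  have hG0 : (0 : PiLp 1 (fun _ : Fin n => E)) ∈ Metric.closedBall (G 0)
      (((R.nnnorm : ℝ)⁻¹ - η) * r) := by
    rw [hR, inv_inv, hη, sub_half, Metric.mem_closedBall, dist_comm, dist_zero_right,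
      norm_eq_sum_of_one]
    have hGi : ∀ i : Fin n, G 0 i = extChartAt 𝓘(ℝ, E) (p ((i : ℕ) + 1)) (f (x (i : ℕ))) -
        extChartAt 𝓘(ℝ, E) (p ((i : ℕ) + 1)) (x ((i : ℕ) + 1)) := fun i => by
      simp only [hG, hξ, PiLp.zero_apply, add_zero, chartMap_extChartAt f _ (hp _).mem_source]
    have hz : ∀ i : Fin n, ((i : ℕ) : ℤ) ≠ k₀ → ‖G 0 i‖ = 0 := fun i hi => by
      rw [hGi, hk₀ _ hi, sub_self, norm_zero]
    by_cases hex : ∃ i : Fin n, ((i : ℕ) : ℤ) = k₀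
    · obtain ⟨i, hi⟩ := hex
      rw [Finset.sum_eq_single i (fun j _ hj => hz j fun h => hj (by ext; omega)) (by simp), hGi]
      exact (hjump _ _ _ (hp _) (by rw [dist_comm]; exact (hx _).2.2)).2.le
    · push Not at hex
      rw [Finset.sum_eq_zero fun i _ => hz i (hex i)]
      positivity
  obtain ⟨v, hv, hGv⟩ := hGapp.surjOn_closedBall_of_nonlinearRightInverse R hr0.le Subset.rfl hG0
  rw [mem_closedBall_zero_iff] at hv
  have hvi : ∀ i, ‖v i‖ ≤ r₂ := fun i =>
    (PiLp.norm_apply_le v i).trans (hv.trans (min_le_right _ _))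
  have hmain : ∀ k (hk : k < n + 1), f^[k] ((extChartAt 𝓘(ℝ, E) (p 0)).symm (ξ 0 + v 0)) =
      (extChartAt 𝓘(ℝ, E) (p k)).symm (ξ k + v ⟨k, hk⟩) := by
    intro k hk
    induction k with
    | zero => rfl
    | succ k ih =>
      rw [Function.iterate_succ_apply', ih (by omega)]
      have h1 : G v ⟨k, by omega⟩ = 0 := by rw [hGv]; rfl
      have h2 := sub_eq_zero.1 h1
      set y := (extChartAt 𝓘(ℝ, E) (p k)).symm (ξ k + v ⟨k, by omega⟩) with hy
      have h3 : extChartAt 𝓘(ℝ, E) (p (k + 1)) (f y) = ξ (k + 1) + v ⟨k + 1, hk⟩ := h2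
      have h4 : dist (x k) y < e₂ :=
        ((hball _ _ _ (hp k) (hvi ⟨k, by omega⟩)).2).trans_le (min_le_right _ _)
      have h5 : dist (f (x k)) (f y) < e₁ / 2 := hfc h4 (hp k).mem
      have h6 : dist (x (k + 1)) (f y) < e₁ := by
        have h7 := dist_triangle_left (x (k + 1)) (f y) (f (x k))
        linarith [(hx k).2.1]
      have h7 := (hsrc _ _ _ (hp (k + 1)) h6).1
      push_cast
      rw [← h3, (extChartAt 𝓘(ℝ, E) (p (k + 1))).left_inv (by simpa using h7)]
  refine ⟨(extChartAt 𝓘(ℝ, E) (p 0)).symm (ξ 0 + v 0), fun k hk => ?_⟩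
  rw [hmain k (by omega)]
  exact ((hball _ _ _ (hp k) (hvi ⟨k, by omega⟩)).2).trans_le (min_le_left _ _)

variable [IsContinuousRiemannianBundle E (fun x : M => TangentSpace 𝓘(ℝ, E) x)]

/-- Local product structure of `K`: the local stable set of a point of `K` meets, in `K`, the local
unstable sets of the points of `K` close to it. -/
lemma IsAS.exists_bracket (h : IsAS f K) {ε : ℝ} (hε : 0 < ε) :
    ∃ δ > 0, ∀ x ∈ K, ∀ y ∈ K, dist x y < δ →
      ∃ z ∈ K, z ∈ localStable f.toEquiv ε x ∧ z ∈ localUnstable f.toEquiv ε y := by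
  obtain ⟨c⟩ := exists_chartCover (E := E) h.isCompact
  have : LocallyCompactSpace M := ChartedSpace.locallyCompactSpace E M
  obtain ⟨e₀, he₀, htrans⟩ := h.transverse
  obtain ⟨e₁, he₁, hcomp⟩ := h.isCompact.exists_isCompact_cthickening
  set ε' := min ε e₀ with hε'
  have hε'0 : 0 < ε' := lt_min hε he₀
  set ρ := min (ε' / 3) e₁ with hρ
  have hρ0 : 0 < ρ := lt_min (by positivity) he₁
  have hρ3 : ρ ≤ ε' / 3 := min_le_left _ _
  obtain ⟨δ, hδ, hshadow⟩ := h.exists_finite_shadow c hρ0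
  refine ⟨min δ (ε' / 3), by positivity, fun x hx y hy hxy => ?_⟩
  obtain ⟨X, rfl, hX⟩ := exists_orbit f.toEquiv x
  obtain ⟨Y, rfl, hY⟩ := exists_orbit f.toEquiv y
  -- The pseudo-orbit made of the past of `y` and of the future of `x`.
  set Z : ℤ → M := fun n => if 0 ≤ n then X n else Y n with hZ
  have hZpos : ∀ n, 0 ≤ n → Z n = X n := fun n hn => if_pos hn
  have hZneg : ∀ n, n < 0 → Z n = Y n := fun n hn => if_neg (not_le.2 hn)
  have hZK : ∀ n, Z n ∈ K := fun n => by
    rcases le_or_gt 0 n with hn | hn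
    · rw [hZpos n hn]; exact orbit_mem (f := f.toEquiv) h.invariant hX hx n
    · rw [hZneg n hn]; exact orbit_mem (f := f.toEquiv) h.invariant hY hy n
  have hZf : ∀ n, n ≠ -1 → f (Z n) = Z (n + 1) := fun n hn => by
    rcases le_or_gt 0 n with hn' | hn'
    · rw [hZpos n hn', hZpos (n + 1) (by omega)]; exact (hX n).symm
    · rw [hZneg n hn', hZneg (n + 1) (by omega)]; exact (hY n).symm
  have hZd : ∀ n, dist (f (Z n)) (Z (n + 1)) < δ := fun n => by
    by_cases hn : n = -1
    · subst hn
      have h1 : f (Z (-1)) = Y 0 := by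
        rw [hZneg _ (by norm_num)]; exact (hY (-1)).symm
      have h2 : Z (-1 + 1) = X 0 := hZpos _ (by norm_num)
      rw [h1, h2, dist_comm]
      exact hxy.trans_le (min_le_left _ _)
    · rw [hZf n hn, dist_self]; exact hδ
  obtain ⟨p, hp⟩ := c.exists_adapted hZK
  have hsh : ∀ m : ℕ, ∃ W : ℤ → M, (∀ n, W (n + 1) = f (W n)) ∧
      ∀ n : ℤ, |n| ≤ m → dist (Z n) (W n) < ρ := by
    intro m
    obtain ⟨w, hw⟩ := hshadow (fun n => Z (n - m)) (fun n => p (n - m)) (fun n => hp _)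
      (fun n => by have := hZd (n - m); rwa [sub_add_eq_add_sub] at this)
      ⟨m - 1, fun n hn => by
        have := hZf (n - m) (by omega); rwa [sub_add_eq_add_sub] at this⟩ (2 * m)
    obtain ⟨W, rfl, hW⟩ := exists_orbit f.toEquiv w
    refine ⟨fun n => W (n + m), fun n => by
      change W (n + 1 + m) = f (W (n + m))
      rw [add_right_comm]; exact hW _, fun n hn => ?_⟩
    rw [abs_le] at hn
    have h1 := hw (n + m).toNat (by omega)
    have h2 := orbit_add hW 0 (n + m).toNat
    have h3 : (((n + m).toNat : ℕ) : ℤ) = n + m := Int.toNat_of_nonneg (by omega)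
    rw [zero_add, h3] at h2
    rw [h3, add_sub_cancel_right] at h1
    change dist (Z n) (W (n + m)) < ρ
    rw [h2]
    exact h1
  -- The orbit sought is a limit of the orbits `W m`, which shadow `Z` on `[-m, m]`.
  choose W hW hWZ using hsh
  set U : Ultrafilter ℕ := hyperfilter ℕ
  have hU : (U : Filter ℕ) ≤ atTop := Nat.hyperfilter_le_atTop
  obtain ⟨z, -, hz⟩ := hcomp.ultrafilter_le_nhds' (U.map fun m => W m 0) (by
    rw [Ultrafilter.mem_map]
    exact Eventually.of_forall fun m => Metric.thickening_subset_cthickening _ _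
      (Metric.mem_thickening_iff.2 ⟨Z 0, hZK 0, by
        rw [dist_comm]; exact (hWZ m 0 (by simp)).trans_le (min_le_right _ _)⟩))
  have hz' : Tendsto (fun m => W m 0) U (𝓝 z) := hz
  have hpos : ∀ n : ℕ, dist (f^[n] (X 0)) (f^[n] z) ≤ ρ := fun n => by
    have h1 := (((f.continuous.iterate n).tendsto z).comp hz').dist
      (tendsto_const_nhds (x := X n))
    have h2 := orbit_add hX 0 n
    rw [zero_add] at h2
    change dist (f.toEquiv^[n] (X 0)) _ ≤ ρ
    rw [← h2, dist_comm]
    refine le_of_tendsto h1 ?_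
    filter_upwards [hU (eventually_ge_atTop n)] with m hm
    have h3 := hWZ m n (by rw [abs_of_nonneg (by positivity)]; exact_mod_cast hm)
    have h4 := orbit_add (f := f.toEquiv) (hW m) 0 n
    rw [zero_add] at h4
    rw [hZpos _ (by positivity), h4, dist_comm] at h3
    exact h3.le
  have hneg : ∀ n : ℕ, n ≠ 0 → dist (f.symm^[n] (Y 0)) (f.symm^[n] z) ≤ ρ := fun n hn => by
    have h1 := (((f.symm.continuous.iterate n).tendsto z).comp hz').dist
      (tendsto_const_nhds (x := Y (-n)))
    have hrev : ∀ V : ℤ → M, (∀ n, V (n + 1) = f (V n)) → V (-n) = f.symm^[n] (V 0) := by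
      intro V hV
      have h2 := orbit_add (f := f.toEquiv.symm) (z := fun n => V (-n))
        (orbit_reverse (f := f.toEquiv) hV) 0 n
      simpa using h2
    rw [← hrev Y hY, dist_comm]
    refine le_of_tendsto h1 ?_
    filter_upwards [hU (eventually_ge_atTop n)] with m hm
    have h3 := hWZ m (-n) (by rw [abs_neg, abs_of_nonneg (by positivity)]; exact_mod_cast hm)
    rw [hZneg _ (by omega), hrev (W m) (hW m), dist_comm] at h3
    exact h3.le
  have hS : z ∈ localStable f.toEquiv ε' (X 0) := fun n => (hpos n).trans_lt (by linarith)
  have hUn : z ∈ localUnstable f.toEquiv ε' (Y 0) := fun n => by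
    rcases eq_or_ne n 0 with rfl | hn
    · have h1 := hpos 0
      have h2 := dist_triangle_left (Y 0) z (X 0)
      have h3 : dist (X 0) (Y 0) < ε' / 3 := hxy.trans_le (min_le_right _ _)
      simp only [Function.iterate_zero, id] at h1 ⊢
      linarith
    · exact (hneg n hn).trans_lt (by linarith)
  exact ⟨z, (htrans ε' hε'0 (min_le_right _ _) _ hx _ hy).2 ⟨hS, hUn⟩,
    localStable_mono _ (min_le_left _ _) _ hS, localStable_mono _ (min_le_left _ _) _ hUn⟩

end Shadowing

/-! ### Following orbits of `K` up to small jumps -/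

/-- The topological properties of an `AS` compact set on which the absence of cycles rests: nearby
points of `K` have local stable and unstable sets that meet in `K`, small local stable and unstable
sets are contained in the global ones, and nonwandering points are limits of periodic points. -/
structure HasLocalProduct {M : Type*} [MetricSpace M] (f : M ≃ M) (K : Set M) : Prop where
  isClosed : IsClosed K
  invariant : f '' K = K
  continuous : Continuous f
  continuous_symm : Continuous f.symm
  bracket : ∀ ε > 0, ∃ δ > 0, ∀ x ∈ K, ∀ y ∈ K, dist x y < δ →
    ∃ z ∈ K, z ∈ localStable f ε x ∧ z ∈ localUnstable f ε y
  stable : ∃ e > 0, ∀ x ∈ K, localStable f e x ⊆ stableSet f x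
  unstable : ∃ e > 0, ∀ x ∈ K, localUnstable f e x ⊆ unstableSet f x
  nonwandering_subset : nonwandering f K ⊆ closure (periodicIn f K)

section Reach

variable {M : Type*} [MetricSpace M] {f : M ≃ M} {K : Set M}

/-- An orbit of `K` follows up to `ε` the past of `x` and, after a finite time, the future of
`y`. -/
def Reach (f : M ≃ M) (K : Set M) (ε : ℝ) (x y : M) : Prop :=
  ∃ h ∈ K, ∃ n : ℕ, h ∈ localUnstable f ε x ∧ f^[n] h ∈ localStable f ε y

/-- Arbitrarily precise orbits of `K` go from the past of `x` to the future of `y`. -/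
def Leads (f : M ≃ M) (K : Set M) (x y : M) : Prop := ∀ ε > 0, Reach f K ε x y

omit [MetricSpace M] in
lemma iterate_symm_iterate (f : M ≃ M) (n : ℕ) (x : M) : f.symm^[n] (f^[n] x) = x :=
  (Function.LeftInverse.iterate f.symm_apply_apply n) x

omit [MetricSpace M] in
lemma iterate_iterate_symm (f : M ≃ M) (n : ℕ) (x : M) : f^[n] (f.symm^[n] x) = x :=
  iterate_symm_iterate f.symm n x

omit [MetricSpace M] in
lemma iterate_mem (hf : f '' K = K) {x : M} (hx : x ∈ K) (n : ℕ) : f^[n] x ∈ K := by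
  induction n with
  | zero => exact hx
  | succ n ih => rw [Function.iterate_succ_apply', ← hf]; exact mem_image_of_mem _ ih

lemma reach_iterate {ε : ℝ} (hε : 0 < ε) {x : M} (hx : x ∈ K) (n : ℕ) :
    Reach f K ε x (f^[n] x) :=
  ⟨x, hx, n, self_mem_localStable _ hε _, self_mem_localStable _ hε _⟩

lemma leads_iterate {x : M} (hx : x ∈ K) (n : ℕ) : Leads f K x (f^[n] x) :=
  fun _ hε => reach_iterate hε hx n

lemma leads_of_iterate_symm (hf : f '' K = K) {x : M} (hx : x ∈ K) (n : ℕ) :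
    Leads f K (f.symm^[n] x) x := by
  have := leads_iterate (f := f) (iterate_mem (image_symm_eq hf) hx n) n
  rwa [iterate_iterate_symm] at this

/-- Two orbits can be concatenated, up to a small error, where a small jump separates them. -/
lemma HasLocalProduct.exists_reach_jump (h : HasLocalProduct f K) {ε : ℝ} (hε : 0 < ε) :
    ∃ δ > 0, ∀ x y y' w, Reach f K δ x y → dist y y' < δ → Reach f K δ y' w → Reach f K ε x w := by
  obtain ⟨δ, hδ, hbr⟩ := h.bracket (ε / 2) (half_pos hε)
  refine ⟨min (ε / 2) (δ / 3), by positivity, ?_⟩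
  rintro x y y' w ⟨h₁, hK₁, n, hx, hy⟩ hyy' ⟨h₂, hK₂, m, hy', hw⟩
  have hd : dist h₂ (f^[n] h₁) < δ := by
    have h1 : dist y (f^[n] h₁) < δ / 3 := (hy 0).trans_le (min_le_right _ _)
    have h2 : dist y' h₂ < δ / 3 := (hy' 0).trans_le (min_le_right _ _)
    have h3 : dist y y' < δ / 3 := hyy'.trans_le (min_le_right _ _)
    have h4 := dist_triangle4 h₂ y' y (f^[n] h₁)
    rw [dist_comm h₂ y', dist_comm y' y] at h4
    linarith
  obtain ⟨z, hzK, hzs, hzu⟩ := hbr h₂ hK₂ _ (iterate_mem h.invariant hK₁ n) hd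
  refine ⟨f.symm^[n] z, iterate_mem (image_symm_eq h.invariant) hzK n, n + m, fun k => ?_,
    fun k => ?_⟩
  · have h1 := hzu (k + n)
    have h2 := (hx k).trans_le (min_le_left _ _)
    rw [Function.iterate_add_apply, Function.iterate_add_apply, iterate_symm_iterate] at h1
    have h3 := dist_triangle (f.symm^[k] x) (f.symm^[k] h₁) (f.symm^[k] (f.symm^[n] z))
    linarith
  · have h1 := hzs (k + m)
    have h2 := (hw k).trans_le (min_le_left _ _)
    rw [Function.iterate_add_apply, Function.iterate_add_apply] at h1
    rw [add_comm n m, Function.iterate_add_apply, iterate_iterate_symm]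
    have h3 := dist_triangle (f^[k] w) (f^[k] (f^[m] h₂)) (f^[k] (f^[m] z))
    linarith

lemma HasLocalProduct.leads_of_approx (h : HasLocalProduct f K) {x w : M}
    (hxw : ∀ δ > 0, ∃ y y', Reach f K δ x y ∧ dist y y' < δ ∧ Reach f K δ y' w) :
    Leads f K x w := fun ε hε => by
  obtain ⟨δ, hδ, hj⟩ := h.exists_reach_jump hε
  obtain ⟨y, y', h1, h2, h3⟩ := hxw δ hδ
  exact hj x y y' w h1 h2 h3

lemma HasLocalProduct.leads_trans (h : HasLocalProduct f K) {x y w : M} (hxy : Leads f K x y)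
    (hyw : Leads f K y w) : Leads f K x w :=
  h.leads_of_approx fun δ hδ => ⟨y, y, hxy δ hδ, by rwa [dist_self], hyw δ hδ⟩

lemma mem_nonwandering_of_leads (hf : f '' K = K) {z : M} (hz : z ∈ K)
    (h : Leads f K (f z) z) : z ∈ nonwandering f K := by
  refine ⟨hz, fun U hU => ?_⟩
  obtain ⟨ε, hε, hball⟩ := Metric.mem_nhds_iff.1 hU
  obtain ⟨y, hy, n, hyu, hys⟩ := h ε hε
  have h1 := hyu 1
  have h2 := hys 0
  simp only [Function.iterate_one, Equiv.symm_apply_apply] at h1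
  have h3 : f^[n + 1] (f.symm y) = f^[n] y := by
    rw [Function.iterate_succ_apply, Equiv.apply_symm_apply]
  refine ⟨n + 1, n.succ_pos, f.symm y, ⟨hball ?_, ?_⟩, ?_⟩
  · rwa [Metric.mem_ball, dist_comm]
  · exact iterate_mem (image_symm_eq hf) hy 1
  · rw [h3]
    exact ⟨hball (by rwa [Metric.mem_ball, dist_comm]), iterate_mem hf hy n⟩

/-! ### Periodic points and basic sets -/

omit [MetricSpace M] in
lemma periodicIn_symm (f : M ≃ M) (K : Set M) : periodicIn f.symm K = periodicIn f K := by
  have key : ∀ g : M ≃ M, periodicIn g K ⊆ periodicIn g.symm K := by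
    rintro g x ⟨hx, n, hn, hp⟩
    refine ⟨hx, n, hn, ?_⟩
    have h1 := iterate_symm_iterate g n x
    rwa [hp.eq] at h1
  exact (key f.symm).antisymm (key f)

omit [MetricSpace M] in
lemma iterate_mem_periodicIn (hf : f '' K = K) {p : M} (hp : p ∈ periodicIn f K) (n : ℕ) :
    f^[n] p ∈ periodicIn f K := by
  obtain ⟨hpK, k, hk, hper⟩ := hp
  exact ⟨iterate_mem hf hpK n, k, hk, hper.apply_iterate n⟩

lemma leads_iterate_self (hf : f '' K = K) {p : M} (hp : p ∈ periodicIn f K) (n : ℕ) :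
    Leads f K (f^[n] p) p := by
  obtain ⟨hpK, k, hk, hper⟩ := hp
  have h1 := leads_iterate (f := f) (iterate_mem hf hpK n) (n * k - n)
  have h2 : n * k - n + n = n * k := Nat.sub_add_cancel (Nat.le_mul_of_pos_right n hk)
  have h3 : f^[n * k] p = p := hper.const_mul n
  rwa [← Function.iterate_add_apply, h2, h3] at h1

lemma leads_self_iterate_symm (hf : f '' K = K) {p : M} (hp : p ∈ periodicIn f K) (n : ℕ) :
    Leads f K p (f.symm^[n] p) := by
  have hp' : f.symm^[n] p ∈ periodicIn f K := by
    rw [← periodicIn_symm] at hp ⊢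
    exact iterate_mem_periodicIn (image_symm_eq hf) hp n
  have h1 := leads_iterate_self hf hp' n
  rwa [iterate_iterate_symm] at h1

lemma HasLocalProduct.leads_of_mem_unstableSet (h : HasLocalProduct f K) {p z : M}
    (hp : p ∈ periodicIn f K) (hz : z ∈ K) (hzp : z ∈ unstableSet f p) : Leads f K p z := by
  refine h.leads_of_approx fun δ hδ => ?_
  obtain ⟨n, hn⟩ := (Filter.Tendsto.eventually hzp (gt_mem_nhds hδ)).exists
  exact ⟨_, _, leads_self_iterate_symm h.invariant hp n δ hδ, hn,
    leads_of_iterate_symm h.invariant hz n δ hδ⟩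

lemma HasLocalProduct.leads_of_mem_stableSet (h : HasLocalProduct f K) {p z : M}
    (hp : p ∈ periodicIn f K) (hz : z ∈ K) (hzp : z ∈ stableSet f p) : Leads f K z p := by
  refine h.leads_of_approx fun δ hδ => ?_
  obtain ⟨n, hn⟩ := (Filter.Tendsto.eventually hzp (gt_mem_nhds hδ)).exists
  exact ⟨_, _, reach_iterate hδ hz n, by rwa [dist_comm],
    leads_iterate_self h.invariant hp n δ hδ⟩

lemma Related.symm {x y : M} (h : Related f K x y) : Related f K y x := ⟨h.2, h.1⟩

lemma HasLocalProduct.leads_of_related (h : HasLocalProduct f K) {x y : M}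
    (hx : x ∈ periodicIn f K) (hy : y ∈ periodicIn f K) (hxy : Related f K x y) :
    Leads f K x y := by
  obtain ⟨z, ⟨hzy, hzK⟩, hzx, -⟩ := hxy.2
  exact h.leads_trans (h.leads_of_mem_unstableSet hx hzK hzx)
    (h.leads_of_mem_stableSet hy hzK hzy)

/-- The basic set that contains the periodic point `p`. -/
def basicSet (f : M ≃ M) (K : Set M) (p : M) : Set M := ⋃ n : ℕ, f^[n] '' piece f K p

lemma related_self {p : M} (hp : p ∈ K) : Related f K p p := by
  have h : ∀ g : M ≃ M, p ∈ stableSet g p := fun g => by simp [stableSet]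
  exact ⟨⟨p, ⟨h f, hp⟩, h f.symm, hp⟩, ⟨p, ⟨h f, hp⟩, h f.symm, hp⟩⟩

lemma self_mem_basicSet {p : M} (hp : p ∈ periodicIn f K) : p ∈ basicSet f K p :=
  mem_iUnion.2 ⟨0, p, subset_closure ⟨hp, related_self hp.1⟩, rfl⟩

lemma exists_near_of_mem_basicSet (hc : Continuous f) {p b : M}
    (hb : b ∈ basicSet f K p) {δ : ℝ} (hδ : 0 < δ) :
    ∃ x ∈ periodicIn f K, Related f K p x ∧ ∃ k : ℕ, dist b (f^[k] x) < δ := by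
  obtain ⟨k, c, hcp, rfl⟩ := mem_iUnion.1 hb
  obtain ⟨x, hx, hxc⟩ := mem_closure_iff_nhds.1 hcp _
    ((hc.iterate k).continuousAt.preimage_mem_nhds (Metric.ball_mem_nhds (f^[k] c) hδ))
  exact ⟨x, hxc.1, hxc.2, k, by rw [dist_comm]; exact hx⟩

lemma HasLocalProduct.basicSet_subset (h : HasLocalProduct f K) {p : M} : basicSet f K p ⊆ K := by
  refine iUnion_subset fun n => ?_
  rintro _ ⟨c, hc, rfl⟩
  exact iterate_mem h.invariant (closure_minimal (fun x hx => hx.1.1) h.isClosed hc) n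

lemma HasLocalProduct.leads_of_mem_basicSet (h : HasLocalProduct f K) {p b : M}
    (hp : p ∈ periodicIn f K) (hb : b ∈ basicSet f K p) : Leads f K p b ∧ Leads f K b p := by
  have hbK := h.basicSet_subset hb
  constructor
  · refine h.leads_of_approx fun δ hδ => ?_
    obtain ⟨x, hx, hpx, k, hk⟩ := exists_near_of_mem_basicSet h.continuous hb hδ
    exact ⟨f^[k] x, b, h.leads_trans (h.leads_of_related hp hx hpx) (leads_iterate hx.1 k) δ hδ,
      by rwa [dist_comm], reach_iterate hδ hbK 0⟩
  · refine h.leads_of_approx fun δ hδ => ?_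
    obtain ⟨x, hx, hpx, k, hk⟩ := exists_near_of_mem_basicSet h.continuous hb hδ
    exact ⟨b, f^[k] x, reach_iterate hδ hbK 0, hk, h.leads_trans
      (leads_iterate_self h.invariant hx k) (h.leads_of_related hx hp hpx.symm) δ hδ⟩

lemma exists_near_of_mem_stableTrace {B : Set M} (hB : B.Nonempty) {z : M}
    (hz : z ∈ stableTrace f K B) {δ : ℝ} (hδ : 0 < δ) : ∃ n : ℕ, ∃ b ∈ B, dist (f^[n] z) b < δ := by
  obtain ⟨n, hn⟩ := (hz.2.eventually (gt_mem_nhds hδ)).exists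
  exact ⟨n, (Metric.infDist_lt_iff hB).1 hn⟩

lemma HasLocalProduct.leads_of_mem_stableTrace (h : HasLocalProduct f K) {p z : M}
    (hp : p ∈ periodicIn f K) (hz : z ∈ stableTrace f K (basicSet f K p)) : Leads f K z p := by
  refine h.leads_of_approx fun δ hδ => ?_
  obtain ⟨n, b, hb, hd⟩ := exists_near_of_mem_stableTrace ⟨p, self_mem_basicSet hp⟩ hz hδ
  exact ⟨_, b, reach_iterate hδ hz.1 n, hd, (h.leads_of_mem_basicSet hp hb).2 δ hδ⟩

lemma HasLocalProduct.leads_of_mem_unstableTrace (h : HasLocalProduct f K) {p z : M}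
    (hp : p ∈ periodicIn f K) (hz : z ∈ unstableTrace f K (basicSet f K p)) : Leads f K p z := by
  refine h.leads_of_approx fun δ hδ => ?_
  obtain ⟨n, b, hb, hd⟩ := exists_near_of_mem_stableTrace ⟨p, self_mem_basicSet hp⟩ hz hδ
  exact ⟨b, _, (h.leads_of_mem_basicSet hp hb).1 δ hδ, by rwa [dist_comm],
    leads_of_iterate_symm h.invariant hz.1 n δ hδ⟩

lemma apply_mem_stableTrace (hf : f '' K = K) {B : Set M} {z : M} (hz : z ∈ stableTrace f K B) :
    f z ∈ stableTrace f K B := by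
  refine ⟨iterate_mem hf hz.1 1, ?_⟩
  have := (tendsto_add_atTop_iff_nat 1).2 hz.2
  simpa only [Function.iterate_succ_apply] using this

/-! ### Homoclinic relation between periodic points -/

lemma iterate_mem_stableSet_iff {x y : M} (n : ℕ) :
    f^[n] y ∈ stableSet f (f^[n] x) ↔ y ∈ stableSet f x := by
  simp only [stableSet, mem_ofPred_eq, ← Function.iterate_add_apply]
  exact tendsto_add_atTop_iff_nat (f := fun k : ℕ => dist (f^[k] x) (f^[k] y)) n

lemma iterate_mem_unstableSet_iff {x y : M} (n : ℕ) :
    f^[n] y ∈ unstableSet f (f^[n] x) ↔ y ∈ unstableSet f x := by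
  have := iterate_mem_stableSet_iff (f := f.symm) (x := f^[n] x) (y := f^[n] y) n
  rw [iterate_symm_iterate, iterate_symm_iterate] at this
  exact this.symm

lemma stableSet_trans {x y z : M} (hy : y ∈ stableSet f x) (hz : z ∈ stableSet f y) :
    z ∈ stableSet f x := by
  refine squeeze_zero (fun _ => dist_nonneg) (fun n => dist_triangle _ (f^[n] y) _) ?_
  simpa using Tendsto.add hy hz

lemma Related.of_iterate (hf : f '' K = K) {x y : M} {n : ℕ}
    (h : Related f K (f^[n] x) (f^[n] y)) : Related f K x y := by
  have key : ∀ x y : M, ((stableSet f (f^[n] x) ∩ K) ∩ (unstableSet f (f^[n] y) ∩ K)).Nonempty →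
      ((stableSet f x ∩ K) ∩ (unstableSet f y ∩ K)).Nonempty := by
    rintro x y ⟨z, ⟨hz1, hzK⟩, hz2, -⟩
    have hzK' := iterate_mem (image_symm_eq hf) hzK n
    rw [← iterate_iterate_symm f n z] at hz1 hz2
    exact ⟨f.symm^[n] z, ⟨(iterate_mem_stableSet_iff n).1 hz1, hzK'⟩,
      (iterate_mem_unstableSet_iff n).1 hz2, hzK'⟩
  exact ⟨key x y h.1, key y x h.2⟩

lemma Related.iterate (hf : f '' K = K) {x y : M} (h : Related f K x y) (n : ℕ) :
    Related f K (f^[n] x) (f^[n] y) := by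
  have key : ∀ x y : M, ((stableSet f x ∩ K) ∩ (unstableSet f y ∩ K)).Nonempty →
      ((stableSet f (f^[n] x) ∩ K) ∩ (unstableSet f (f^[n] y) ∩ K)).Nonempty := by
    rintro x y ⟨z, ⟨hz1, hzK⟩, hz2, -⟩
    have hzK' := iterate_mem hf hzK n
    exact ⟨f^[n] z, ⟨(iterate_mem_stableSet_iff n).2 hz1, hzK'⟩,
      (iterate_mem_unstableSet_iff n).2 hz2, hzK'⟩
  exact ⟨key x y h.1, key y x h.2⟩

/-- The local stable set of a point of `K` meets the local unstable set of a nearby one, with both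
contained in the global sets. -/
lemma HasLocalProduct.exists_global_bracket (h : HasLocalProduct f K) :
    ∃ δ > 0, ∀ x ∈ K, ∀ y ∈ K, dist x y < δ →
      ∃ z ∈ K, z ∈ stableSet f x ∧ z ∈ unstableSet f y := by
  obtain ⟨e₁, he₁, h₁⟩ := h.stable
  obtain ⟨e₂, he₂, h₂⟩ := h.unstable
  obtain ⟨δ, hδ, hbr⟩ := h.bracket (min e₁ e₂) (lt_min he₁ he₂)
  refine ⟨δ, hδ, fun x hx y hy hxy => ?_⟩
  obtain ⟨z, hz, hzs, hzu⟩ := hbr x hx y hy hxy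
  exact ⟨z, hz, h₁ x hx (localStable_mono _ (min_le_left _ _) _ hzs),
    h₂ y hy (localStable_mono _ (min_le_right _ _) _ hzu)⟩

lemma HasLocalProduct.related_trans (h : HasLocalProduct f K) {x y w : M}
    (hx : x ∈ periodicIn f K) (hy : y ∈ periodicIn f K) (hw : w ∈ periodicIn f K)
    (hxy : Related f K x y) (hyw : Related f K y w) : Related f K x w := by
  obtain ⟨δ, hδ, hbr⟩ := h.exists_global_bracket
  have key : ∀ x w : M, x ∈ periodicIn f K → w ∈ periodicIn f K →
      ((stableSet f x ∩ K) ∩ (unstableSet f y ∩ K)).Nonempty →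
      ((stableSet f y ∩ K) ∩ (unstableSet f w ∩ K)).Nonempty →
      ((stableSet f x ∩ K) ∩ (unstableSet f w ∩ K)).Nonempty := by
    rintro x w ⟨-, N₁, hN₁, hx⟩ ⟨-, N₃, hN₃, hw⟩ ⟨h₁, ⟨h₁x, h₁K⟩, h₁y, -⟩ ⟨h₂, ⟨h₂y, h₂K⟩, h₂w, -⟩
    obtain ⟨-, N₂, hN₂, hy⟩ := hy
    -- All the periodic points are fixed by the iterate of order `N`.
    set N := N₁ * N₂ * N₃ with hN
    have hN0 : 0 < N := by positivity
    have hxN : Function.IsPeriodicPt f N x := hx.trans_dvd ⟨N₂ * N₃, by rw [hN]; ring⟩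
    have hyN : Function.IsPeriodicPt f N y := hy.trans_dvd ⟨N₁ * N₃, by rw [hN]; ring⟩
    have hwN : Function.IsPeriodicPt f N w := hw.trans_dvd ⟨N₁ * N₂, by rw [hN]; ring⟩
    have hfix : ∀ v, Function.IsPeriodicPt f N v →
        ∀ m : ℕ, f^[m * N] v = v ∧ f.symm^[m * N] v = v := fun v hv m => by
        have h1 : f^[m * N] v = v := hv.const_mul m
        refine ⟨h1, ?_⟩
        have h2 := iterate_symm_iterate f (m * N) v
        rwa [h1] at h2
    obtain ⟨m₀, hm₀⟩ := eventually_atTop.1 ((Filter.Tendsto.eventually h₁y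
      (gt_mem_nhds (half_pos hδ))).and (Filter.Tendsto.eventually h₂y (gt_mem_nhds (half_pos hδ))))
    set m := m₀ * N with hm
    obtain ⟨hd1, hd2⟩ := hm₀ m (Nat.le_mul_of_pos_right m₀ hN0)
    rw [(hfix y hyN m₀).2] at hd1
    rw [(hfix y hyN m₀).1] at hd2
    obtain ⟨g, hgK, hgs, hgu⟩ := hbr (f.symm^[m] h₁)
      (iterate_mem (image_symm_eq h.invariant) h₁K m) (f^[m] h₂) (iterate_mem h.invariant h₂K m) (by
        have := dist_triangle_left (f.symm^[m] h₁) (f^[m] h₂) y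
        linarith)
    refine ⟨g, ⟨stableSet_trans (y := f.symm^[m] h₁) ?_ hgs, hgK⟩,
      stableSet_trans (y := f^[m] h₂) ?_ hgu, hgK⟩
    · rw [← iterate_mem_stableSet_iff m, iterate_iterate_symm, (hfix x hxN m₀).1]
      exact h₁x
    · have h3 := (iterate_mem_unstableSet_iff m).2 h₂w
      rw [(hfix w hwN m₀).1] at h3
      exact h3
  exact ⟨key x w hx hw hxy.1 hyw.1, key w x hw hx hyw.2 hxy.2⟩

/-- A limit of periodic points whose future orbit converges to a basic set belongs to it: the nearby
periodic points are related to points of the orbit of `p`. -/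
lemma HasLocalProduct.mem_basicSet (h : HasLocalProduct f K) {p z : M} (hp : p ∈ periodicIn f K)
    (hz : z ∈ closure (periodicIn f K)) (hzB : z ∈ stableTrace f K (basicSet f K p)) :
    z ∈ basicSet f K p := by
  obtain ⟨δ, hδ, hbr⟩ := h.exists_global_bracket
  obtain ⟨n, b, hb, hd⟩ := exists_near_of_mem_stableTrace ⟨p, self_mem_basicSet hp⟩ hzB
    (show 0 < δ / 3 by positivity)
  obtain ⟨x, hx, hpx, k, hk⟩ := exists_near_of_mem_basicSet h.continuous hb
    (show 0 < δ / 3 by positivity)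
  obtain ⟨N, hN, hper⟩ := hp.2
  set R : Set M := {x | x ∈ periodicIn f K ∧ Related f K p x} with hR
  have hmem : ∀ q ∈ periodicIn f K, dist (f^[n] z) (f^[n] q) < δ / 3 →
      q ∈ ⋃ l ∈ Finset.range N, f^[l] '' R := by
    intro q hq hqz
    have hdist : dist (f^[n] q) (f^[k] x) < δ := by
      have := dist_triangle4 (f^[n] q) (f^[n] z) b (f^[k] x)
      rw [dist_comm (f^[n] z)] at hqz
      linarith
    have hqn := iterate_mem_periodicIn h.invariant hq n
    have hxk := iterate_mem_periodicIn h.invariant hx k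
    have hpk := iterate_mem_periodicIn h.invariant hp k
    have hrel : Related f K (f^[n] q) (f^[k] x) := by
      obtain ⟨u, hu, hu1, hu2⟩ := hbr _ hqn.1 _ hxk.1 hdist
      obtain ⟨v, hv, hv1, hv2⟩ := hbr _ hxk.1 _ hqn.1 (by rwa [dist_comm])
      exact ⟨⟨u, ⟨hu1, hu⟩, hu2, hu⟩, v, ⟨hv1, hv⟩, hv2, hv⟩
    have hrel' := h.related_trans hqn hxk hpk hrel (hpx.symm.iterate h.invariant k)
    -- The phase of `q` relative to the orbit of `p`, computed modulo the period.
    set l := (k + (n * N - n)) % N with hl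
    have hpl : f^[k] p = f^[n] (f^[l] p) := by
      have h1 : f^[l] p = f^[k + (n * N - n)] p := hper.iterate_mod_apply _
      have h2 : n + (k + (n * N - n)) = k + n * N := by
        have := Nat.le_mul_of_pos_right n hN
        omega
      rw [h1, ← Function.iterate_add_apply, h2, Function.iterate_add_apply,
        (hper.const_mul n).eq]
    rw [hpl] at hrel'
    have hql := hrel'.of_iterate h.invariant
    rw [← iterate_iterate_symm f l q] at hql
    refine mem_iUnion₂.2 ⟨l, Finset.mem_range.2 (Nat.mod_lt _ hN), f.symm^[l] q,
      ⟨?_, (hql.of_iterate h.invariant).symm⟩, iterate_iterate_symm f l q⟩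
    rw [← periodicIn_symm] at hq ⊢
    exact iterate_mem_periodicIn (image_symm_eq h.invariant) hq l
  have hcl : z ∈ closure (⋃ l ∈ Finset.range N, f^[l] '' R) := by
    refine mem_closure_iff_nhds.2 fun U hU => ?_
    obtain ⟨q, ⟨hqU, hqz⟩, hq⟩ := mem_closure_iff_nhds.1 hz _ (inter_mem hU
      ((h.continuous.iterate n).continuousAt.preimage_mem_nhds (Metric.ball_mem_nhds (f^[n] z)
        (show 0 < δ / 3 by positivity))))
    exact ⟨q, hqU, hmem q hq (by rw [dist_comm]; exact hqz)⟩
  have hclosed : IsClosed (⋃ l ∈ Finset.range N, f^[l] '' piece f K p) := by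
    refine isClosed_biUnion_finset fun l _ => ?_
    have : f^[l] '' piece f K p = f.symm^[l] ⁻¹' piece f K p :=
      congrFun (image_eq_preimage_of_inverse (iterate_symm_iterate f l)
        (iterate_iterate_symm f l)) _
    rw [this]
    exact isClosed_closure.preimage (h.continuous_symm.iterate l)
  have hsub := closure_minimal (iUnion₂_mono fun l _ => image_mono subset_closure) hclosed hcl
  obtain ⟨l, -, hl⟩ := mem_iUnion₂.1 hsub
  exact mem_iUnion.2 ⟨l, hl⟩

/-- A connection between basic sets cannot be closed up: otherwise its points would be nonwandering,
hence in the basic set that they converge to. -/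
lemma HasLocalProduct.not_leads_of_succ (h : HasLocalProduct f K) {p q : M}
    (hp : p ∈ periodicIn f K) (hq : q ∈ periodicIn f K)
    (hpq : Succ f K (basicSet f K p) (basicSet f K q)) : ¬ Leads f K q p := by
  intro hqp
  obtain ⟨z, ⟨hzu, -⟩, hzs, hzq⟩ := hpq
  have h1 : Leads f K (f z) z := h.leads_trans
    (h.leads_of_mem_stableTrace hq (apply_mem_stableTrace h.invariant hzs))
    (h.leads_trans hqp (h.leads_of_mem_unstableTrace hp hzu))
  exact hzq (h.mem_basicSet hq
    (h.nonwandering_subset (mem_nonwandering_of_leads h.invariant hzs.1 h1)) hzs)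

lemma HasLocalProduct.leads_of_succ (h : HasLocalProduct f K) {p q : M}
    (hp : p ∈ periodicIn f K) (hq : q ∈ periodicIn f K)
    (hpq : Succ f K (basicSet f K p) (basicSet f K q)) : Leads f K p q := by
  obtain ⟨z, ⟨hzu, -⟩, hzs, -⟩ := hpq
  exact h.leads_trans (h.leads_of_mem_unstableTrace hp hzu) (h.leads_of_mem_stableTrace hq hzs)

/-! ### The order on basic sets -/

/-- The no-cycle condition: a genuine connection in a cycle would be closed up by the other ones. -/
theorem HasLocalProduct.eq_of_cycle (h : HasLocalProduct f K) (n : ℕ) (c : ℕ → Set M)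
    (hc : ∀ j, c j ∈ basicSets f K) (hn : c n = c 0)
    (hs : ∀ j < n, c (j + 1) = c j ∨ Succ f K (c (j + 1)) (c j)) (j : ℕ) (hj : j < n) :
    c j = c (j + 1) := by
  choose P hP hPB using fun B : basicSets f K => B.2
  have hPB' : ∀ B, basicSet f K (P B) = (B : Set M) := fun B => (hPB B).symm
  set C : ℕ → basicSets f K := fun j => ⟨c j, hc j⟩
  have hCn : C n = C 0 := Subtype.ext hn
  have hleads : ∀ i k, i ≤ k → k ≤ n → Leads f K (P (C k)) (P (C i)) := by
    intro i k hik
    induction k, hik using Nat.le_induction with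
    | base => exact fun _ => leads_iterate (hP _).1 0
    | succ k hik ih =>
      intro hk
      rcases hs k (by omega) with heq | hsucc
      · rw [show C (k + 1) = C k from Subtype.ext heq]; exact ih (by omega)
      · refine h.leads_trans (h.leads_of_succ (hP _) (hP _) ?_) (ih (by omega))
        rwa [hPB', hPB']
  rcases hs j hj with heq | hsucc
  · exact heq.symm
  · refine absurd ?_ (h.not_leads_of_succ (hP (C (j + 1))) (hP (C j)) (by rwa [hPB', hPB']))
    have h1 := hleads 0 j (Nat.zero_le _) hj.le
    rw [← hCn] at h1
    exact h.leads_trans h1 (hleads (j + 1) n hj le_rfl)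

/-- By the absence of cycles the reflexive transitive closure of the connections is a partial order,
and no basic set is connected to itself. -/
theorem HasLocalProduct.exists_linearOrder (h : HasLocalProduct f K) :
    ∃ r : LinearOrder (basicSets f K),
      ∀ A B : basicSets f K, Succ f K (A : Set M) (B : Set M) → r.lt B A := by
  choose P hP hPB using fun B : basicSets f K => B.2
  have hPB' : ∀ B, basicSet f K (P B) = (B : Set M) := fun B => (hPB B).symm
  set below : basicSets f K → basicSets f K → Prop := fun A B => Succ f K (B : Set M) (A : Set M)
  have hnot : ∀ A B, below A B → ¬ Leads f K (P A) (P B) := fun A B hAB =>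
    h.not_leads_of_succ (hP B) (hP A) (by rw [hPB', hPB']; exact hAB)
  have hleads : ∀ A B, Relation.ReflTransGen below A B → Leads f K (P B) (P A) := by
    intro A B hAB
    induction hAB with
    | refl => exact leads_iterate (hP A).1 0
    | tail _ hstep ih =>
      exact h.leads_trans (h.leads_of_succ (hP _) (hP _) (by rw [hPB', hPB']; exact hstep)) ih
  have hpo : IsPartialOrder (basicSets f K) (Relation.ReflTransGen below) :=
    { refl := fun _ => Relation.ReflTransGen.refl
      trans := fun _ _ _ => Relation.ReflTransGen.trans
      antisymm := fun A B hAB hBA => by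
        rcases hAB.cases_head with heq | ⟨A', hstep, hrest⟩
        · exact heq
        · exact absurd (h.leads_trans (hleads _ _ hBA) (hleads _ _ hrest)) (hnot A A' hstep) }
  obtain ⟨s, hs, hle⟩ := extend_partialOrder (Relation.ReflTransGen below)
  refine ⟨{ le := s
            lt := fun A B => s A B ∧ ¬ s B A
            lt_iff_le_not_ge := fun _ _ => Iff.rfl
            le_refl := fun A => hs.refl A
            le_trans := fun A B C => hs.trans A B C
            le_antisymm := fun A B => hs.antisymm A B
            le_total := fun A B => hs.total A B
            toDecidableLE := Classical.decRel _ }, fun A B hAB => ?_⟩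
  have h1 : s B A := hle _ _ (Relation.ReflTransGen.single hAB)
  refine ⟨h1, fun h2 => ?_⟩
  have heq : A = B := hs.antisymm A B h2 h1
  subst heq
  exact hnot A A hAB (leads_iterate (hP A).1 0)

end Reach

section AS

variable {E : Type*} [NormedAddCommGroup E] [NormedSpace ℝ E] [FiniteDimensional ℝ E]
  {M : Type*} [MetricSpace M] [ChartedSpace E M] [IsManifold 𝓘(ℝ, E) 1 M]
  [RiemannianBundle (fun x : M => TangentSpace 𝓘(ℝ, E) x)]
  [IsContinuousRiemannianBundle E (fun x : M => TangentSpace 𝓘(ℝ, E) x)]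

lemma IsAS.hasLocalProduct {f : M ≃ₘ^1⟮𝓘(ℝ, E), 𝓘(ℝ, E)⟯ M} {K : Set M} (h : IsAS f K) :
    HasLocalProduct f.toEquiv K where
  isClosed := h.isCompact.isClosed
  invariant := h.invariant
  continuous := f.continuous
  continuous_symm := f.symm.continuous
  bracket := fun _ hε => h.exists_bracket hε
  stable := exists_localStable_subset_stableSet h.isCompact h.invariant h.hyperbolic
  unstable := exists_localStable_subset_stableSet (f := f.symm) h.isCompact
    (image_symm_eq (f := f.toEquiv) h.invariant)
    ((nonwandering_symm f.toEquiv K).symm ▸ h.hyperbolic.symm)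
  nonwandering_subset := h.periodic_dense.subset

end AS

end ASCompact

theorem mainTheorem6
    {E : Type*} [NormedAddCommGroup E] [NormedSpace ℝ E] [FiniteDimensional ℝ E]
    {M : Type*} [MetricSpace M] [ChartedSpace E M] [IsManifold 𝓘(ℝ, E) 1 M]
    [RiemannianBundle (fun x : M => TangentSpace 𝓘(ℝ, E) x)]
    [IsContinuousRiemannianBundle E (fun x : M => TangentSpace 𝓘(ℝ, E) x)]
    (f : M ≃ₘ^1⟮𝓘(ℝ, E), 𝓘(ℝ, E)⟯ M) (K : Set M) (hK : ASCompact.IsAS f K) :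
    (∀ (n : ℕ) (c : ℕ → Set M),
      (∀ j, c j ∈ ASCompact.basicSets f.toEquiv K) → c n = c 0 →
      (∀ j < n, c (j + 1) = c j ∨ ASCompact.Succ f.toEquiv K (c (j + 1)) (c j)) →
      ∀ j < n, c j = c (j + 1)) ∧
    ∃ r : LinearOrder (ASCompact.basicSets f.toEquiv K),
      ∀ A B : ASCompact.basicSets f.toEquiv K,
        ASCompact.Succ f.toEquiv K (A : Set M) (B : Set M) → r.lt B A :=
  ⟨hK.hasLocalProduct.eq_of_cycle, hK.hasLocalProduct.exists_linearOrder⟩
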